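/- **Setting.** Let $\mathcal A$ be a finite-dimensional $C^*$-algebra, embedded as a unital $*$-subalgebra of the $d_{\mathcal A}\times d_{\mathcal A}$ complex matrices, and let $\omega$ be a translation invariant state on the chain with one copy of $\mathcal A$ at each site of $\mathbb Z$. Its marginal on $k$ consecutive sites is $\omega_k$, identified with its density matrix in $\mathcal A^{\otimes k}$; a matrix $D$ is viewed as the functional $X\mapsto\mathrm{Tr}(DX)$, and $\|\cdot\|_2$ is the Hilbert–Schmidt norm. A realization of $\omega$ consists of a finite-dimensional complex vector space $V$, a vector $e\in V$, a linear map $A\mapsto\mathbb E_A$ from $\mathcal A$ to $\mathrm{End}(V)$ and a functional $\rho\in V^*$ with $\omega(A_1\otimes\cdots\otimes A_n)=\rho\,\mathbb E_{A_1}\cdots\mathbb E_{A_n}(e)$, $\rho\,\mathbb E_{\mathbb 1}=\rho$ and $\mathbb E_{\mathbb 1}(e)=e$. Assume that $\omega$ is finitely correlated, i.e. has a realization, and let $m$ be the minimal dimension of $V$. For blocks of $k$ sites on the left and $l$ sites on the right of a cut let $\Omega:\mathcal A^{\otimes l}\to(\mathcal A^{\otimes k})^*$, $\Omega(X)[Y]=\omega(Y\otimes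 X)$. Let $t_1^*,t_2^*$ be such that for $k=t_1^*$, $l=t_2^*$ this map has rank $m$, and let $s\ge\max(t_1^*,t_2^*)$. From now on $\Omega$ denotes the map with $k=l=s$, and $\sigma_m(\Omega)$ is its $m$-th largest (its smallest nonzero) singular value with respect to the Hilbert–Schmidt inner products. **Algorithm LearnFCS.** Fix self-adjoint Hilbert–Schmidt-orthonormal bases $(Y_j)$ and $(X_i)$ of $\mathcal A^{\otimes s}$ and $(Z_k)$ of $\mathcal A$. The input consists of a threshold $\eta\in\mathbb R$ and of matrices $\hat\omega_s,\hat\omega_{2s},\hat\omega_{2s+1}$ (estimates of the marginals, viewed as functionals, not necessarily states). Put $\hat\Omega_{ji}=\hat\omega_{2s}(Y_j\otimes X_i)$, $(\hat\Omega_A)_{ji}=\hat\omega_{2s+1}(Y_j\otimes A\otimes X_i)$, take any singular value decomposition of $\hat\Omega$, and let $\hat U$ be the matrix of those left singular vectors whose singular value is at least $\eta$. With $^+$ the Moore–Penrose pseudo-inverse, put $$\hat e=\hat U^\dagger\big(\hat\omega_s(Y_j)\big)_j,\qquad \hat\rho=\big(\hat\omega_s(X_i)\big)_i(\hat U^\dagger\hat\Omega)^+,\qquad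 \hat{\mathbb K}_A=\hat U^\dagger\hat\Omega_A(\hat U^\dagger\hat\Omega)^+ .$$ The output is the matrix product operator (not necessarily positive) on $t$ sites $$\hat\omega_t=\sum_{k_1,\dots,k_t}\big(\hat\rho\,\hat{\mathbb K}_{Z_{k_1}}\cdots\hat{\mathbb K}_{Z_{k_t}}\hat e\big)\,Z_{k_1}\otimes\cdots\otimes Z_{k_t}.$$ **Theorem.** Let $t\ge1$, $0<\epsilon<1$, $$\varepsilon=\frac{\epsilon\,\sigma_m(\Omega)^3}{20\,t\,m\sqrt{d_{\mathcal A}}},\qquad \sigma_m(\Omega)/2\ \ge\ \eta\ \ge\ 2\varepsilon .$$ 1. If $\|\hat\omega_s-\omega_s\|_2\le\varepsilon$, $\|\hat\omega_{2s}-\omega_{2s}\|_2\le\varepsilon$ and $\|\hat\omega_{2s+1}-\omega_{2s+1}\|_2\le\varepsilon$, then the output of LearnFCS satisfies $d_{\mathrm{Tr}}(\hat\omega_t,\omega_t)=\tfrac12\|\hat\omega_t-\omega_t\|_1\le\epsilon$. 2. Consequently, if the three estimates are computed from the outcome of any measurement (POVM) on $n$ copies of $\omega_{2s+1}$, and $n$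 is such that with probability at least $1-p$ all three have Hilbert–Schmidt error at most $\varepsilon$, then with probability at least $1-p$ the output satisfies $d_{\mathrm{Tr}}(\hat\omega_t,\omega_t)\le\epsilon$. -/

import Mathlib

open Matrix MeasureTheory
open scoped ENNReal ComplexOrder

noncomputable section

namespace FCS

/-! ### Operators on a finite block of sites -/

/-- Tensor product `a 0 ⊗ ⋯ ⊗ a (n-1)` of matrices, as a matrix on the product index set. -/
def tensorProd {ι : Type*} {n : ℕ} (a : Fin n → Matrix ι ι ℂ) :
    Matrix (Fin n → ι) (Fin n → ι) ℂ :=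
  Matrix.of fun x y => ∏ k, a k (x k) (y k)

/-- Operators on `n` consecutive sites, each with Hilbert space `ℂ ^ d`. -/
abbrev Op (d n : ℕ) : Type := Matrix (Fin n → Fin d) (Fin n → Fin d) ℂ

/-- `X ⊗ Y` on `k + l` sites: `X` on the first `k` sites, `Y` on the last `l` sites. -/
def tens {d k l : ℕ} (X : Op d k) (Y : Op d l) : Op d (k + l) :=
  Matrix.of fun x y =>
    X (fun a => x (Fin.castAdd l a)) (fun a => y (Fin.castAdd l a)) *
      Y (fun b => x (Fin.natAdd k b)) (fun b => y (Fin.natAdd k b))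

/-- A one-site operator regarded as an operator on a block of one site. -/
def oneSite {d : ℕ} (A : Matrix (Fin d) (Fin d) ℂ) : Op d 1 := tensorProd fun _ => A

/-- The algebra `𝒜 ⊗ ⋯ ⊗ 𝒜` (`n` factors) of a block of `n` sites, as the linear span of the
elementary tensors with factors in the one-site algebra `𝒜`. -/
def blockAlg {d : ℕ} (𝒜 : StarSubalgebra ℂ (Matrix (Fin d) (Fin d) ℂ)) (n : ℕ) :
    Submodule ℂ (Op d n) :=
  Submodule.span ℂ {T | ∃ a : Fin n → Matrix (Fin d) (Fin d) ℂ, (∀ k, a k ∈ 𝒜) ∧ T = tensorProd a}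

/-! ### Translation invariant states and finitely correlated states -/

/-- A translation invariant state on the infinite chain with one-site algebra `𝒜`, where `𝒜` is a
unital `*`-subalgebra of the `d × d` matrices. It is given by its marginals on the blocks of `n`
consecutive sites, each of them represented by its density matrix in the block algebra, so that the
expectation of `X` in the block algebra is `trace (dens n * X)`. The last two fields say that the
marginals are compatible with adding sites on the right and on the left; together they express
both that the marginals come from one state on the chain and that this state is translation
invariant. -/
structure TIState {d : ℕ} (𝒜 : StarSubalgebra ℂ (Matrix (Fin d) (Fin d) ℂ)) where
  dens : ∀ n : ℕ, Op d n
  mem : ∀ n, dens n ∈ blockAlg 𝒜 n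
  posSemidef : ∀ n, (dens n).PosSemidef
  trace_one : ∀ n, (dens n).trace = 1
  right_compat : ∀ k l, ∀ X ∈ blockAlg 𝒜 k,
    (dens (k + l) * tens X (1 : Op d l)).trace = (dens k * X).trace
  left_compat : ∀ k l, ∀ X ∈ blockAlg 𝒜 l,
    (dens (k + l) * tens (1 : Op d k) X).trace = (dens l * X).trace

variable {d : ℕ} {𝒜 : StarSubalgebra ℂ (Matrix (Fin d) (Fin d) ℂ)}

/-- A (linear) realization `(V, e, 𝔼, ρ)` of a translation invariant state, with memory `V`. -/
structure Realization (ω : TIState 𝒜) (V : Type*) [AddCommGroup V] [Module ℂ V] where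
  e : V
  E : 𝒜 →ₗ[ℂ] Module.End ℂ V
  rho : Module.Dual ℂ V
  expect : ∀ (n : ℕ) (a : Fin n → 𝒜),
    (ω.dens n * tensorProd fun k => (a k : Matrix (Fin d) (Fin d) ℂ)).trace =
      rho ((List.ofFn fun k => E (a k)).prod e)
  rho_E_one : rho ∘ₗ E 1 = rho
  E_one_e : E 1 e = e

/-- `ω` is finitely correlated, and the minimal dimension of a realization of it is `m`. -/
def IsFinitelyCorrelatedOfDim (ω : TIState 𝒜) (m : ℕ) : Prop :=
  IsLeast {k : ℕ | Nonempty (Realization ω (Fin k → ℂ))} m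

/-- The map `Ω : X ↦ (Y ↦ ω (Y ⊗ X))` from the algebra of the `l` sites to the right of a cut to
the linear functionals on the algebra of the `k` sites to the left of the cut. -/
def omegaMap (ω : TIState 𝒜) (k l : ℕ) :
    blockAlg 𝒜 l →ₗ[ℂ] Module.Dual ℂ (blockAlg 𝒜 k) :=
  LinearMap.mk₂ ℂ (fun X Y => (ω.dens (k + l) * tens (Y : Op d k) (X : Op d l)).trace)
    (fun X X' Y => by
      rw [← Matrix.trace_add, ← Matrix.mul_add]
      congr 2
      ext x y
      simp [tens, mul_add])
    (fun c X Y => by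
      rw [← Matrix.trace_smul, ← Matrix.mul_smul]
      congr 2
      ext x y
      simp [tens, mul_left_comm])
    (fun X Y Y' => by
      rw [← Matrix.trace_add, ← Matrix.mul_add]
      congr 2
      ext x y
      simp [tens, add_mul])
    (fun c X Y => by
      rw [← Matrix.trace_smul, ← Matrix.mul_smul]
      congr 2
      ext x y
      simp [tens, mul_assoc])

/-! ### Norms, singular values, pseudo-inverse -/

/-- The Hilbert-Schmidt norm. -/
def hsNorm {ι ι' : Type*} [Fintype ι] [Fintype ι'] (M : Matrix ι ι' ℂ) : ℝ :=
  √(∑ i, ∑ j, ‖M i j‖ ^ 2)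

/-- The `k`-th largest singular value, `k = 1, 2, …` (Mathlib counts from `0`). -/
def nthSingularValue {ι ι' : Type*} [Fintype ι] [Fintype ι'] [DecidableEq ι']
    (M : Matrix ι ι' ℂ) (k : ℕ) : ℝ :=
  (Matrix.toEuclideanLin M).singularValues (k - 1)

/-- The trace norm: the sum of all singular values. -/
def traceNorm {ι ι' : Type*} [Fintype ι] [Fintype ι'] [DecidableEq ι']
    (M : Matrix ι ι' ℂ) : ℝ :=
  (Matrix.toEuclideanLin M).singularValues.sum fun _ x => x

/-- The trace distance. -/
def trDist {ι : Type*} [Fintype ι] [DecidableEq ι] (M N : Matrix ι ι ℂ) : ℝ :=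
  (1 / 2) * traceNorm (M - N)

/-- The four Penrose equations. -/
structure IsMoorePenrose {ι κ : Type*} [Fintype ι] [Fintype κ]
    (A : Matrix ι κ ℂ) (B : Matrix κ ι ℂ) : Prop where
  mul_mul_left : A * B * A = A
  mul_mul_right : B * A * B = B
  isHermitian_left : (A * B).IsHermitian
  isHermitian_right : (B * A).IsHermitian

theorem exists_isMoorePenrose {ι κ : Type*} [Fintype ι] [Fintype κ] (A : Matrix ι κ ℂ) :
    ∃ B : Matrix κ ι ℂ, IsMoorePenrose A B := by
  classical
  have hH : (Aᴴ * A).IsHermitian := isHermitian_conjTranspose_mul_self A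
  obtain ⟨V, Λ, hV, hV', hA⟩ : ∃ (V : Matrix κ κ ℂ) (Λ : κ → ℝ), Vᴴ * V = 1 ∧ V * Vᴴ = 1 ∧
      Aᴴ * A = V * diagonal (fun i => (Λ i : ℂ)) * Vᴴ := by
    refine ⟨hH.eigenvectorUnitary, hH.eigenvalues, ?_, ?_, ?_⟩
    · exact (Matrix.mem_unitaryGroup_iff').1 hH.eigenvectorUnitary.2
    · exact (Matrix.mem_unitaryGroup_iff).1 hH.eigenvectorUnitary.2
    · have := hH.spectral_theorem
      rw [Unitary.conjStarAlgAut_apply] at this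
      exact this
  set D : Matrix κ κ ℂ := diagonal (fun i => (Λ i : ℂ)) with hD
  set I : Matrix κ κ ℂ := diagonal (fun i => ((Λ i)⁻¹ : ℂ)) with hI
  have hIh : Iᴴ = I := by
    rw [hI, diagonal_conjTranspose]; congr 1; ext i; simp
  have hIDI : I * D * I = I := by
    simp only [hI, hD, diagonal_mul_diagonal]; congr 1; ext i
    by_cases h : (Λ i : ℂ) = 0 <;> simp [h]
  have hDID : D * I * D = D := by
    simp only [hI, hD, diagonal_mul_diagonal]; congr 1; ext i
    by_cases h : (Λ i : ℂ) = 0 <;> simp [h]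
  have hIDh : (I * D)ᴴ = I * D := by
    simp only [hI, hD, diagonal_mul_diagonal, diagonal_conjTranspose]; congr 1; ext i; simp
  set G : Matrix κ κ ℂ := V * I * Vᴴ with hG
  have hGh : Gᴴ = G := by
    simp [hG, conjTranspose_mul, hIh, Matrix.mul_assoc]
  have hGA : G * (Aᴴ * A) = V * (I * D) * Vᴴ := by
    rw [hA, hG]
    calc V * I * Vᴴ * (V * D * Vᴴ) = V * I * (Vᴴ * V) * D * Vᴴ := by simp only [Matrix.mul_assoc]
      _ = _ := by rw [hV, Matrix.mul_one]; simp only [Matrix.mul_assoc]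
  have hAGA : (Aᴴ * A) * G * (Aᴴ * A) = Aᴴ * A := by
    rw [Matrix.mul_assoc, hGA, hA]
    calc V * D * Vᴴ * (V * (I * D) * Vᴴ) = V * D * (Vᴴ * V) * (I * D) * Vᴴ := by
          simp only [Matrix.mul_assoc]
      _ = V * (D * I * D) * Vᴴ := by rw [hV, Matrix.mul_one]; simp only [Matrix.mul_assoc]
      _ = _ := by rw [hDID]
  have hGAG : G * (Aᴴ * A) * G = G := by
    rw [hGA, hG]
    calc V * (I * D) * Vᴴ * (V * I * Vᴴ) = V * (I * D) * (Vᴴ * V) * I * Vᴴ := by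
          simp only [Matrix.mul_assoc]
      _ = V * (I * D * I) * Vᴴ := by rw [hV, Matrix.mul_one]; simp only [Matrix.mul_assoc]
      _ = _ := by rw [hIDI]
  refine ⟨G * Aᴴ, ?_, ?_, ?_, ?_⟩
  · have h0 : Aᴴ * (A * (G * Aᴴ) * A - A) = 0 := by
      rw [Matrix.mul_sub, sub_eq_zero, ← hAGA]
      simp only [Matrix.mul_assoc]
    have h1 : (A * (G * Aᴴ) * A - A)ᴴ * (A * (G * Aᴴ) * A - A) = 0 := by
      have : A * (G * Aᴴ) * A - A = A * (G * Aᴴ * A - 1) := by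
        rw [Matrix.mul_sub, Matrix.mul_one]; simp only [Matrix.mul_assoc]
      nth_rewrite 1 [this]
      rw [conjTranspose_mul, Matrix.mul_assoc, h0, Matrix.mul_zero]
    exact sub_eq_zero.1 (conjTranspose_mul_self_eq_zero.1 h1)
  · calc G * Aᴴ * A * (G * Aᴴ) = (G * (Aᴴ * A) * G) * Aᴴ := by simp only [Matrix.mul_assoc]
      _ = _ := by rw [hGAG]
  · simp [IsHermitian, conjTranspose_mul, hGh, Matrix.mul_assoc]
  · have : G * Aᴴ * A = V * (I * D) * Vᴴ := by rw [Matrix.mul_assoc, hGA]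
    rw [this, IsHermitian, conjTranspose_mul, conjTranspose_mul, hIDh, conjTranspose_conjTranspose]
    simp only [Matrix.mul_assoc]

/-- The Moore-Penrose pseudo-inverse `A⁺`, the (unique) solution of the Penrose equations. -/
def pinv {ι κ : Type*} [Fintype ι] [Fintype κ] (A : Matrix ι κ ℂ) : Matrix κ ι ℂ :=
  (exists_isMoorePenrose A).choose

/-- A singular value decomposition `M = U D Wᴴ` of a square matrix. -/
structure SVD {ι : Type*} [Fintype ι] [DecidableEq ι] (M : Matrix ι ι ℂ) where
  U : Matrix ι ι ℂ
  sv : ι → ℝ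
  W : Matrix ι ι ℂ
  U_mem : U ∈ Matrix.unitaryGroup ι ℂ
  W_mem : W ∈ Matrix.unitaryGroup ι ℂ
  sv_nonneg : ∀ i, 0 ≤ sv i
  eq : M = U * Matrix.diagonal (fun i => (sv i : ℂ)) * Wᴴ

/-- The left singular vectors (columns of `U`) whose singular values are at least `η`. -/
def SVD.truncU {ι : Type*} [Fintype ι] [DecidableEq ι] {M : Matrix ι ι ℂ} (S : SVD M) (η : ℝ) :
    Matrix ι {i : ι // η ≤ S.sv i} ℂ :=
  S.U.submatrix id Subtype.val

/-! ### The spectral learning algorithm -/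

/-- `b` is a basis of the space `S` of matrices that consists of self-adjoint matrices and is
orthonormal for the Hilbert-Schmidt inner product. -/
structure IsHSBasis {ι κ : Type*} [Fintype ι] [DecidableEq κ]
    (S : Submodule ℂ (Matrix ι ι ℂ)) (b : κ → Matrix ι ι ℂ) : Prop where
  isHermitian : ∀ i, (b i).IsHermitian
  orthonormal : ∀ i j, (b i * b j).trace = if i = j then 1 else 0
  span_eq : Submodule.span ℂ (Set.range b) = S

/-- The data that tomography hands to the algorithm: estimates of the marginals on
`s`, `2 s` and `2 s + 1` sites. They need not be states. -/
structure Estimates (d s : ℕ) where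
  one : Op d s
  two : Op d (s + s)
  three : Op d (s + 1 + s)

/-- All three estimates have Hilbert-Schmidt error at most `δ`. -/
def Estimates.Accurate {s : ℕ} (est : Estimates d s) (ω : TIState 𝒜) (δ : ℝ) : Prop :=
  hsNorm (est.one - ω.dens s) ≤ δ ∧ hsNorm (est.two - ω.dens (s + s)) ≤ δ ∧
    hsNorm (est.three - ω.dens (s + 1 + s)) ≤ δ

/-- The matrix of `Ω` in the bases `Y` (left block), `X` (right block), computed from the
functional on `2 s` sites represented by `D`: entry `(j, i)` is `Ω(X i)[Y j]`. -/
def omegaMatrix {s : ℕ} {ι : Type*} (D : Op d (s + s)) (Y X : ι → Op d s) : Matrix ι ι ℂ :=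
  Matrix.of fun j i => (D * tens (Y j) (X i)).trace

/-- The matrix of `Ω_A`, computed from the functional on `2 s + 1` sites represented by `D`:
entry `(j, i)` is `Ω_A(X i)[Y j]`. -/
def omegaMatrixAt {s : ℕ} {ι : Type*} (D : Op d (s + 1 + s)) (Y X : ι → Op d s)
    (A : Matrix (Fin d) (Fin d) ℂ) : Matrix ι ι ℂ :=
  Matrix.of fun j i => (D * tens (tens (Y j) (oneSite A)) (X i)).trace

section Algorithm

variable {s : ℕ} {ι κ : Type*} [Fintype ι] [DecidableEq ι] [Fintype κ]
  (Y X : ι → Op d s) (Z : κ → Matrix (Fin d) (Fin d) ℂ) (η : ℝ) (est : Estimates d s)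
  (S : SVD (omegaMatrix est.two Y X))

/-- The estimate of `e`. -/
def hatE : {i : ι // η ≤ S.sv i} → ℂ :=
  (S.truncU η)ᴴ *ᵥ fun j => (est.one * Y j).trace

/-- The estimate of `ρ`. -/
def hatRho : {i : ι // η ≤ S.sv i} → ℂ :=
  (fun i => (est.one * X i).trace) ᵥ* pinv ((S.truncU η)ᴴ * omegaMatrix est.two Y X)

/-- The estimate of `𝕂_A`. -/
def hatK (A : Matrix (Fin d) (Fin d) ℂ) :
    Matrix {i : ι // η ≤ S.sv i} {i : ι // η ≤ S.sv i} ℂ :=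
  (S.truncU η)ᴴ * omegaMatrixAt est.three Y X A *
    pinv ((S.truncU η)ᴴ * omegaMatrix est.two Y X)

/-- The output of the algorithm for `t` sites: the matrix product operator representing the
functional whose value on `Z (k 0) ⊗ ⋯ ⊗ Z (k (t - 1))` is `ρ̂ 𝕂̂_{Z (k 0)} ⋯ 𝕂̂_{Z (k (t - 1))} ê`,
where `Z` is a self-adjoint orthonormal basis of the one-site algebra. -/
def learnFCS (t : ℕ) : Op d t :=
  ∑ k : Fin t → κ,
    (hatRho Y X η est S ⬝ᵥ
        ((List.ofFn fun i => hatK Y X η est S (Z (k i))).prod *ᵥ hatE Y X η est S)) •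
      tensorProd fun i => Z (k i)

end Algorithm

/-! ### Measurements -/

/-- A positive operator valued measure with outcome space `Θ`, on matrices indexed by `ι`. -/
structure Measurement (ι Θ : Type*) [Fintype ι] [DecidableEq ι] [MeasurableSpace Θ] where
  effect : Set Θ → Matrix ι ι ℂ
  posSemidef : ∀ E, MeasurableSet E → (effect E).PosSemidef
  effect_univ : effect Set.univ = 1
  hasSum_effect : ∀ f : ℕ → Set Θ, (∀ k, MeasurableSet (f k)) →
    Pairwise (Function.onFun Disjoint f) → HasSum (fun k => effect (f k)) (effect (⋃ k, f k))

/-- `μ` is the law of the outcome when `M` is applied to a system with density matrix `ρ`. -/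
def Measurement.IsOutcomeLaw {ι Θ : Type*} [Fintype ι] [DecidableEq ι] [MeasurableSpace Θ]
    (M : Measurement ι Θ) (ρ : Matrix ι ι ℂ) (μ : Measure Θ) : Prop :=
  ∀ E, MeasurableSet E → μ E = ENNReal.ofReal (ρ * M.effect E).trace.re

end FCS

end

/-! A realization is determined only up to a change of basis of the memory, so the output is
compared with the true state in a gauge adapted to the estimate. Let `U` hold the retained left
singular vectors of the estimated `Ω`, let `G` be the pseudo-inverse used by the algorithm, and let
`G'` be a nearby exact right inverse of `Uᴴ * Ω`. The operators y_α = ∑ conj(U_jα) Y_j and x_β = ∑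
G'_iβ X_i then satisfy ω(y_α ⊗ x_β) = δ_αβ. Correlations across any cut factor through `m`
dimensions, and exactly `m` singular values are retained, so duality forces ω(A ⊗ B) = ∑_β ω(A ⊗
x_β) ω(y_β ⊗ B) (`Realization.dualFrame`). Hence ω is the matrix product with row ω(x_β), transfer
operators ω(y_β ⊗ · ⊗ x_γ) and column ω(y_β), and the data of the algorithm are small perturbations
of these.

The number `m` is squeezed from two sides. A Weyl-type argument gives at least `m` estimated
singular values above σ - δ (`SVD.le_card_of_perturbation`), while more than `m` values above η
would give a dual family too large for the realization (`Realization.card_le_of_dual`). As η ≤ σ -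
δ, no singular value lies in between.

Errors must not grow exponentially with the number of sites. Contracting a density matrix with `y`
on the left and `z` on the right costs only their Hilbert-Schmidt norms in trace norm, whatever lies
between (`nuc_ptr`). Error families are therefore measured after contraction with an arbitrary
remainder of the true chain (`ContractBound`); appending an exact transfer operator then loses
nothing, and each perturbed site contributes one factor 1 + θ with θ of order ε / t. Trace norms
enter only through upper bounds, certified by the rank one decompositions of `Nuc`. -/

noncomputable section

namespace FCS

/-! ### Hilbert-Schmidt norm and Euclidean norm of coordinate vectors -/

/-- The Euclidean norm of a coordinate vector. -/
def vecNorm {α : Type*} [Fintype α] (u : α → ℂ) : ℝ := √(∑ i, ‖u i‖ ^ 2)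

section Norms

variable {α β γ : Type*} [Fintype α] [Fintype β] [Fintype γ]

theorem vecNorm_eq_norm (u : α → ℂ) : vecNorm u = ‖WithLp.toLp 2 u‖ := by
  rw [EuclideanSpace.norm_eq]; rfl

theorem vecNorm_nonneg (u : α → ℂ) : 0 ≤ vecNorm u := Real.sqrt_nonneg _

theorem vecNorm_sq (u : α → ℂ) : vecNorm u ^ 2 = ∑ i, ‖u i‖ ^ 2 :=
  Real.sq_sqrt (by positivity)

theorem hsNorm_nonneg (M : Matrix α β ℂ) : 0 ≤ hsNorm M := Real.sqrt_nonneg _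

theorem hsNorm_sq (M : Matrix α β ℂ) : hsNorm M ^ 2 = ∑ i, ∑ j, ‖M i j‖ ^ 2 :=
  Real.sq_sqrt (by positivity)

theorem hsNorm_sq_eq_sum_row (M : Matrix α β ℂ) : hsNorm M ^ 2 = ∑ i, vecNorm (M i) ^ 2 := by
  simp only [hsNorm_sq, vecNorm_sq]

theorem hsNorm_eq_vecNorm (M : Matrix α β ℂ) :
    hsNorm M = vecNorm (fun p : α × β => M p.1 p.2) := by
  rw [hsNorm, vecNorm, Fintype.sum_prod_type]

theorem vecNorm_smul (c : ℂ) (u : α → ℂ) : vecNorm (c • u) = ‖c‖ * vecNorm u := by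
  rw [vecNorm_eq_norm, vecNorm_eq_norm, WithLp.toLp_smul, norm_smul]

theorem vecNorm_add_le (u v : α → ℂ) : vecNorm (u + v) ≤ vecNorm u + vecNorm v := by
  simp only [vecNorm_eq_norm, WithLp.toLp_add]
  exact norm_add_le _ _

theorem vecNorm_sub_rev (u v : α → ℂ) : vecNorm (u - v) = vecNorm (v - u) := by
  simp only [vecNorm_eq_norm, WithLp.toLp_sub]
  exact norm_sub_rev _ _

theorem vecNorm_star (u : α → ℂ) : vecNorm (star u) = vecNorm u := by
  simp [vecNorm]

theorem norm_sum_mul_le (u v : α → ℂ) : ‖∑ i, u i * v i‖ ≤ vecNorm u * vecNorm v := by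
  refine (norm_sum_le _ _).trans ?_
  simp only [norm_mul]
  exact Real.sum_mul_le_sqrt_mul_sqrt _ _ _

theorem norm_dotProduct_le (u v : α → ℂ) : ‖u ⬝ᵥ v‖ ≤ vecNorm u * vecNorm v :=
  norm_sum_mul_le u v

theorem norm_trace_mul_le (M : Matrix α β ℂ) (N : Matrix β α ℂ) :
    ‖(M * N).trace‖ ≤ hsNorm M * hsNorm N := by
  have h := norm_sum_mul_le (fun p : α × β => M p.1 p.2) (fun p : α × β => N p.2 p.1)
  have h2 : vecNorm (fun p : α × β => N p.2 p.1) = hsNorm N := by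
    rw [hsNorm, vecNorm, Fintype.sum_prod_type, Finset.sum_comm]
  rw [h2, ← hsNorm_eq_vecNorm, Fintype.sum_prod_type] at h
  simpa [Matrix.trace, Matrix.mul_apply] using h

theorem vecNorm_mulVec_le (M : Matrix α β ℂ) (v : β → ℂ) :
    vecNorm (M *ᵥ v) ≤ hsNorm M * vecNorm v := by
  refine le_of_sq_le_sq ?_ (mul_nonneg (hsNorm_nonneg _) (vecNorm_nonneg _))
  rw [mul_pow, hsNorm_sq_eq_sum_row, vecNorm_sq, Finset.sum_mul]
  refine Finset.sum_le_sum fun i _ => ?_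
  rw [← mul_pow]
  exact pow_le_pow_left₀ (norm_nonneg _) (norm_dotProduct_le _ _) 2

theorem hsNorm_conjTranspose (M : Matrix α β ℂ) : hsNorm Mᴴ = hsNorm M := by
  rw [hsNorm, hsNorm, Finset.sum_comm]; simp

theorem hsNorm_sq_eq_sum_col (M : Matrix α β ℂ) :
    hsNorm M ^ 2 = ∑ j, vecNorm (fun i => M i j) ^ 2 := by
  simp only [hsNorm_sq, vecNorm_sq]; exact Finset.sum_comm

theorem hsNorm_mul_le_of_left {M : Matrix α β ℂ} {c : ℝ}
    (h : ∀ v, vecNorm (M *ᵥ v) ≤ c * vecNorm v) (hc : 0 ≤ c) (N : Matrix β γ ℂ) :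
    hsNorm (M * N) ≤ c * hsNorm N := by
  refine le_of_sq_le_sq ?_ (mul_nonneg hc (hsNorm_nonneg _))
  rw [mul_pow, hsNorm_sq_eq_sum_col, hsNorm_sq_eq_sum_col, Finset.mul_sum]
  refine Finset.sum_le_sum fun j _ => ?_
  rw [← mul_pow]
  exact pow_le_pow_left₀ (vecNorm_nonneg _) (h fun i => N i j) 2

theorem hsNorm_mul_le (M : Matrix α β ℂ) (N : Matrix β γ ℂ) :
    hsNorm (M * N) ≤ hsNorm M * hsNorm N :=
  hsNorm_mul_le_of_left (vecNorm_mulVec_le M) (hsNorm_nonneg _) N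

theorem hsNorm_smul (c : ℂ) (M : Matrix α β ℂ) : hsNorm (c • M) = ‖c‖ * hsNorm M := by
  simp only [hsNorm_eq_vecNorm, ← vecNorm_smul]; rfl

theorem hsNorm_add_le (M N : Matrix α β ℂ) : hsNorm (M + N) ≤ hsNorm M + hsNorm N := by
  simp only [hsNorm_eq_vecNorm]; exact vecNorm_add_le _ _

theorem hsNorm_one [DecidableEq α] : hsNorm (1 : Matrix α α ℂ) = √(Fintype.card α) := by
  rw [hsNorm]
  congr 1
  have : ∀ i : α, ∑ j, ‖(1 : Matrix α α ℂ) i j‖ ^ 2 = 1 := fun i => by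
    rw [Finset.sum_eq_single i] <;> simp +contextual [eq_comm]
  simp [this]

/-- The trace of a Gram matrix is the squared Hilbert-Schmidt norm of its factor, so the factor of a
density matrix plays the role of a normalized purification. -/
theorem exists_eq_conjTranspose_mul_self {D : Matrix α α ℂ} (hD : D.PosSemidef)
    (htr : D.trace = 1) : ∃ (k : ℕ) (S : Matrix (Fin k) α ℂ), D = Sᴴ * S ∧ hsNorm S = 1 := by
  obtain ⟨k, v, hv⟩ := Matrix.posSemidef_iff_eq_sum_vecMulVec.1 hD
  have hS : D = (Matrix.of fun i a => star (v i a))ᴴ * (Matrix.of fun i a => star (v i a)) := by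
    rw [hv]
    ext a b
    simp [Matrix.sum_apply, vecMulVec_apply, Matrix.mul_apply]
  refine ⟨k, _, hS, ?_⟩
  have h : ((hsNorm (Matrix.of fun i a => star (v i a)) ^ 2 : ℝ) : ℂ) = 1 := by
    rw [← htr, hS, hsNorm_sq, Finset.sum_comm]
    simp only [Matrix.trace, Matrix.diag, Matrix.mul_apply, Matrix.conjTranspose_apply]
    push_cast
    refine Finset.sum_congr rfl fun a _ => Finset.sum_congr rfl fun i _ => ?_
    rw [← Complex.conj_mul']; rfl
  have h2 : hsNorm (Matrix.of fun i a => star (v i a)) ^ 2 = 1 := by exact_mod_cast h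
  exact (pow_eq_one_iff_of_nonneg (hsNorm_nonneg _) two_ne_zero).1 h2

theorem hsNorm_le_one_of_posSemidef {D : Matrix α α ℂ} (hD : D.PosSemidef)
    (htr : D.trace = 1) : hsNorm D ≤ 1 := by
  obtain ⟨k, S, rfl, hS⟩ := exists_eq_conjTranspose_mul_self hD htr
  refine (hsNorm_mul_le _ _).trans ?_
  rw [hsNorm_conjTranspose, hS, one_mul]

end Norms

/-! ### Bounds for the trace norm -/

/-- `Nuc M c` means that `M` is a sum of rank one matrices `u vᵀ` for which the sum of the
`‖u‖ ‖v‖` is at most `c`. -/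
inductive Nuc {α : Type*} [Fintype α] : Matrix α α ℂ → ℝ → Prop
  | zero : Nuc 0 0
  | rank_one (u v : α → ℂ) : Nuc (vecMulVec u v) (vecNorm u * vecNorm v)
  | add {M N : Matrix α α ℂ} {a b : ℝ} : Nuc M a → Nuc N b → Nuc (M + N) (a + b)
  | mono {M : Matrix α α ℂ} {a b : ℝ} : Nuc M a → a ≤ b → Nuc M b

namespace Nuc

variable {α β : Type*} [Fintype α] [Fintype β] {M N : Matrix α α ℂ} {a b : ℝ}

theorem nonneg (h : Nuc M a) : 0 ≤ a := by
  induction h with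
  | zero => exact le_rfl
  | rank_one u v => exact mul_nonneg (vecNorm_nonneg _) (vecNorm_nonneg _)
  | add _ _ h1 h2 => exact add_nonneg h1 h2
  | mono _ h1 h2 => exact h2.trans h1

theorem smul (h : Nuc M a) (c : ℂ) : Nuc (c • M) (‖c‖ * a) := by
  induction h with
  | zero => simpa using Nuc.zero
  | rank_one u v =>
    rw [← Matrix.smul_vecMulVec, ← mul_assoc, ← vecNorm_smul]; exact .rank_one _ _
  | add _ _ h1 h2 => rw [smul_add, mul_add]; exact h1.add h2
  | mono _ h1 h2 => exact h2.mono (mul_le_mul_of_nonneg_left h1 (norm_nonneg _))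

theorem sum {ι : Type*} (s : Finset ι) {M : ι → Matrix α α ℂ} {a : ι → ℝ}
    (h : ∀ i ∈ s, Nuc (M i) (a i)) : Nuc (∑ i ∈ s, M i) (∑ i ∈ s, a i) := by
  classical
  induction s using Finset.induction_on with
  | empty => simpa using Nuc.zero
  | insert i s hi ih =>
    rw [Finset.sum_insert hi, Finset.sum_insert hi]
    exact (h i (Finset.mem_insert_self i s)).add
      (ih fun j hj => h j (Finset.mem_insert_of_mem hj))

theorem submatrix (h : Nuc M a) (e : β ≃ α) : Nuc (M.submatrix e e) a := by
  induction h with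
  | zero => simpa using Nuc.zero
  | rank_one u v =>
    have hv : ∀ u : α → ℂ, vecNorm u = vecNorm (u ∘ e) := fun u => by
      simp [vecNorm, Equiv.sum_comp e (fun i => ‖u i‖ ^ 2)]
    rw [hv u, hv v]; exact .rank_one _ _
  | add _ _ h1 h2 => exact h1.add h2
  | mono _ h1 h2 => exact h2.mono h1

/-- The product is the sum of column times row over the inner index; Cauchy-Schwarz over that index
bounds the sum of the norms. -/
theorem mul (B : Matrix α β ℂ) (C : Matrix β α ℂ) : Nuc (B * C) (hsNorm B * hsNorm C) := by
  have h : B * C = ∑ k, vecMulVec (fun i => B i k) (C k) := by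
    ext i j; simp [Matrix.mul_apply, Matrix.sum_apply, vecMulVec_apply]
  rw [h]
  refine (Nuc.sum Finset.univ fun k _ => Nuc.rank_one (fun i => B i k) (C k)).mono ?_
  refine (Real.sum_mul_le_sqrt_mul_sqrt _ _ _).trans (le_of_eq ?_)
  rw [← hsNorm_sq_eq_sum_col, ← hsNorm_sq_eq_sum_row, Real.sqrt_sq (hsNorm_nonneg _),
    Real.sqrt_sq (hsNorm_nonneg _)]

theorem of_hsNorm [DecidableEq α] (M : Matrix α α ℂ) :
    Nuc M (√(Fintype.card α) * hsNorm M) := by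
  have := Nuc.mul M (1 : Matrix α α ℂ)
  rwa [Matrix.mul_one, hsNorm_one, mul_comm] at this

/-- For a rank one term this is Cauchy-Schwarz followed by Bessel's inequality for each of the two
families; the general case follows by additivity. -/
theorem norm_sum_inner_le (h : Nuc M a) {ι : Type*} [Fintype ι] {u v : ι → EuclideanSpace ℂ α}
    (hu : Orthonormal ℂ u) (hv : Orthonormal ℂ v) [DecidableEq α] :
    ‖∑ i, inner ℂ (u i) (Matrix.toEuclideanLin M (v i))‖ ≤ a := by
  induction h with
  | zero => simp
  | rank_one x y =>
    have h1 : ∀ i, inner ℂ (u i) (Matrix.toEuclideanLin (vecMulVec x y) (v i)) =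
        inner ℂ (u i) (WithLp.toLp 2 x) * inner ℂ (WithLp.toLp 2 (star y)) (v i) := by
      intro i
      have : Matrix.toEuclideanLin (vecMulVec x y) (v i) =
          (inner ℂ (WithLp.toLp 2 (star y)) (v i) : ℂ) • WithLp.toLp 2 x := by
        ext j
        simp [Matrix.toLpLin_apply, Matrix.vecMulVec_mulVec, PiLp.inner_apply, dotProduct,
          mul_comm]
      rw [this, inner_smul_right, mul_comm]
    simp only [h1]
    refine (norm_sum_mul_le _ _).trans ?_
    refine mul_le_mul ?_ ?_ (vecNorm_nonneg _) (vecNorm_nonneg _)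
    · refine le_of_sq_le_sq ?_ (vecNorm_nonneg _)
      rw [vecNorm_sq, vecNorm_eq_norm]
      exact hu.sum_inner_products_le _
    · refine le_of_sq_le_sq ?_ (vecNorm_nonneg _)
      rw [vecNorm_sq, ← vecNorm_star y, vecNorm_eq_norm]
      simp only [norm_inner_symm (WithLp.toLp 2 (star y))]
      exact hv.sum_inner_products_le _
  | add _ _ h1 h2 =>
    simp only [map_add, LinearMap.add_apply, inner_add_right, Finset.sum_add_distrib]
    exact (norm_add_le _ _).trans (add_le_add h1 h2)
  | mono _ h1 h2 => exact h2.trans h1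

end Nuc

section SingularValues

variable {α : Type*} [Fintype α] [DecidableEq α]

/-- Pairing left with right singular vectors turns the sum of inner products in
`Nuc.norm_sum_inner_le` into the sum of the singular values. -/
theorem Nuc.traceNorm_le {M : Matrix α α ℂ} {c : ℝ} (h : Nuc M c) : traceNorm M ≤ c := by
  set T := Matrix.toEuclideanLin M with hT
  have hn : Module.finrank ℂ (EuclideanSpace ℂ α) = Fintype.card α := finrank_euclideanSpace
  set b := T.isSymmetric_adjoint_comp_self.eigenvectorBasis hn with hb
  have hTT : ∀ i j, inner ℂ (T (b i)) (T (b j)) =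
      if i = j then ((T.singularValues j : ℝ) : ℂ) ^ 2 else 0 := by
    intro i j
    have h1 : inner ℂ (T (b i)) (T (b j)) = inner ℂ (b i) ((LinearMap.adjoint T ∘ₗ T) (b j)) := by
      rw [LinearMap.comp_apply, LinearMap.adjoint_inner_right]
    rw [h1, hb, LinearMap.IsSymmetric.apply_eigenvectorBasis, ← T.sq_singularValues_fin hn,
      inner_smul_right, ← hb, orthonormal_iff_ite.1 b.orthonormal]
    split_ifs <;> simp
  -- Only nonzero singular values are kept, so that the left vectors `T (b i)` can be normalized.
  let I := {i : Fin (Fintype.card α) // T.singularValues i ≠ 0}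
  let u : I → EuclideanSpace ℂ α := fun i => ((T.singularValues i : ℝ) : ℂ)⁻¹ • T (b i)
  let v : I → EuclideanSpace ℂ α := fun i => b i
  have hv : Orthonormal ℂ v := b.orthonormal.comp _ Subtype.val_injective
  have hu : Orthonormal ℂ u := by
    rw [orthonormal_iff_ite]
    intro i j
    have hi : ((T.singularValues i : ℝ) : ℂ) ≠ 0 := by exact_mod_cast i.2
    simp only [u, inner_smul_left, inner_smul_right, hTT]
    by_cases hij : i = j
    · subst hij; simp; field_simp
    · have : (i : Fin (Fintype.card α)) ≠ j := fun h => hij (Subtype.ext h)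
      simp [hij, this]
  have hsum : ‖∑ i, inner ℂ (u i) (T (v i))‖ ≤ c := h.norm_sum_inner_le hu hv
  have hval : ∀ i : I, inner ℂ (u i) (T (v i)) = ((T.singularValues i : ℝ) : ℂ) := by
    intro i
    have hi : ((T.singularValues i : ℝ) : ℂ) ≠ 0 := by exact_mod_cast i.2
    simp only [u, v, inner_smul_left, hTT]
    simp; field_simp
  have htn : traceNorm M = ∑ i : I, T.singularValues i := by
    rw [traceNorm, Finsupp.sum_of_support_subset (s := Finset.range (Fintype.card α)),
      Finset.sum_range]
    · rw [← Fintype.sum_subtype_add_sum_subtype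
        (fun i : Fin (Fintype.card α) => T.singularValues i ≠ 0), add_eq_left]
      exact Finset.sum_eq_zero fun i _ => not_not.1 i.2
    · intro i hi
      rw [Finset.mem_range]
      by_contra hc
      rw [Finsupp.mem_support_iff] at hi
      exact hi (T.singularValues_of_finrank_le (by rw [hn]; omega))
    · simp
  simp only [hval] at hsum
  rw [htn]
  refine (le_abs_self _).trans ?_
  rw [← Real.norm_eq_abs, ← Complex.norm_real, Complex.ofReal_sum]
  exact hsum

end SingularValues

/-! ### Tensor products of blocks -/

section Tensor

variable {d : ℕ}

theorem tens_add_left {k l : ℕ} (A A' : Op d k) (B : Op d l) :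
    tens (A + A') B = tens A B + tens A' B := by
  ext; simp [tens, add_mul]

theorem tens_add_right {k l : ℕ} (A : Op d k) (B B' : Op d l) :
    tens A (B + B') = tens A B + tens A B' := by
  ext; simp [tens, mul_add]

theorem tens_sub_left {k l : ℕ} (A A' : Op d k) (B : Op d l) :
    tens (A - A') B = tens A B - tens A' B := by
  ext; simp [tens, sub_mul]

theorem tens_sub_right {k l : ℕ} (A : Op d k) (B B' : Op d l) :
    tens A (B - B') = tens A B - tens A B' := by
  ext; simp [tens, mul_sub]

theorem tens_smul_left {k l : ℕ} (c : ℂ) (A : Op d k) (B : Op d l) :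
    tens (c • A) B = c • tens A B := by
  ext; simp [tens, mul_assoc]

theorem tens_smul_right {k l : ℕ} (c : ℂ) (A : Op d k) (B : Op d l) :
    tens A (c • B) = c • tens A B := by
  ext; simp [tens, mul_left_comm]

theorem tens_zero_left {k l : ℕ} (B : Op d l) : tens (0 : Op d k) B = 0 := by
  ext; simp [tens]

theorem tens_zero_right {k l : ℕ} (A : Op d k) : tens A (0 : Op d l) = 0 := by
  ext; simp [tens]

theorem tens_sum_left {k l : ℕ} {τ : Type*} (s : Finset τ) (A : τ → Op d k) (B : Op d l) :
    tens (∑ i ∈ s, A i) B = ∑ i ∈ s, tens (A i) B := by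
  ext; simp [tens, Matrix.sum_apply, Finset.sum_mul]

theorem tens_sum_right {k l : ℕ} {τ : Type*} (s : Finset τ) (A : Op d k) (B : τ → Op d l) :
    tens A (∑ i ∈ s, B i) = ∑ i ∈ s, tens A (B i) := by
  ext; simp [tens, Matrix.sum_apply, Finset.mul_sum]

theorem tens_assoc {k l n : ℕ} (A : Op d k) (B : Op d l) (C : Op d n) :
    tens (tens A B) C = (tens A (tens B C)).submatrix
      (Equiv.arrowCongr (finCongr (add_assoc k l n)) (Equiv.refl _))
      (Equiv.arrowCongr (finCongr (add_assoc k l n)) (Equiv.refl _)) := by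
  ext x y
  have h : ∀ (x : Fin (k + l + n) → Fin d) (b : Fin n), x (Fin.natAdd (k + l) b) =
      Equiv.arrowCongr (finCongr (add_assoc k l n)) (Equiv.refl _) x
        (Fin.natAdd k (Fin.natAdd l b)) :=
    fun x b => congrArg x (Fin.ext (by simp [add_assoc]))
  simp only [tens, Matrix.of_apply, Matrix.submatrix_apply, mul_assoc, h]
  rfl

theorem tensorProd_append {k l : ℕ} (a : Fin k → Matrix (Fin d) (Fin d) ℂ)
    (b : Fin l → Matrix (Fin d) (Fin d) ℂ) :
    tensorProd (Fin.append a b) = tens (tensorProd a) (tensorProd b) := by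
  ext x y
  simp [tensorProd, tens, Fin.prod_univ_add]

theorem tensorProd_one {n : ℕ} :
    tensorProd (fun _ : Fin n => (1 : Matrix (Fin d) (Fin d) ℂ)) = 1 := by
  ext x y
  simp only [tensorProd, Matrix.of_apply, Matrix.one_apply, Finset.prod_ite_zero, funext_iff]
  simp

theorem tensorProd_eq_one (a : Fin 0 → Matrix (Fin d) (Fin d) ℂ) : tensorProd a = 1 := by
  rw [← tensorProd_one]; congr 1; exact Subsingleton.elim _ _

theorem tens_one_zero {k : ℕ} (A : Op d k) : tens A (1 : Op d 0) = A := by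
  ext x y
  simp only [tens, Matrix.of_apply]
  rw [Subsingleton.elim (fun b : Fin 0 => x (Fin.natAdd k b)) (fun b => y (Fin.natAdd k b)),
    Matrix.one_apply_eq, mul_one]
  rfl

theorem trace_tensorProd_mul_tensorProd {n : ℕ} (a b : Fin n → Matrix (Fin d) (Fin d) ℂ) :
    (tensorProd a * tensorProd b).trace = ∏ k, (a k * b k).trace := by
  simp only [Matrix.trace, Matrix.diag, Matrix.mul_apply, tensorProd, Matrix.of_apply,
    ← Finset.prod_mul_distrib, Finset.prod_univ_sum, Fintype.piFinset_univ]

theorem sum_append {M : Type*} [AddCommMonoid M] {k l : ℕ} {τ : Type*} [Fintype τ]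
    (f : (Fin (k + l) → τ) → M) :
    ∑ x, f x = ∑ a : Fin k → τ, ∑ b : Fin l → τ, f (Fin.append a b) := by
  rw [← Equiv.sum_comp (Fin.appendEquiv k l), Fintype.sum_prod_type]
  rfl

theorem tens_append {k l : ℕ} (A : Op d k) (B : Op d l) (a a' : Fin k → Fin d)
    (b b' : Fin l → Fin d) :
    tens A B (Fin.append a b) (Fin.append a' b') = A a a' * B b b' := by
  simp [tens]

theorem hsNorm_tens {k l : ℕ} (A : Op d k) (B : Op d l) :
    hsNorm (tens A B) = hsNorm A * hsNorm B := by
  rw [hsNorm, hsNorm, hsNorm, ← Real.sqrt_mul (by positivity)]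
  congr 1
  simp only [sum_append, tens_append, norm_mul, mul_pow, Finset.sum_mul_sum]

theorem trace_tens_mul_tens {k l : ℕ} (A A' : Op d k) (B B' : Op d l) :
    (tens A B * tens A' B').trace = (A * A').trace * (B * B').trace := by
  simp only [Matrix.trace, Matrix.diag, Matrix.mul_apply, sum_append, tens_append,
    Finset.sum_mul_sum]
  refine Finset.sum_congr rfl fun a _ => Finset.sum_congr rfl fun b _ =>
    Finset.sum_congr rfl fun a' _ => Finset.sum_congr rfl fun b' _ => ?_
  ring

theorem vecNorm_append {k l : ℕ} (u : (Fin k → Fin d) → ℂ) (v : (Fin l → Fin d) → ℂ) :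
    vecNorm (fun x : Fin (k + l) → Fin d =>
      u (fun a => x (Fin.castAdd l a)) * v (fun b => x (Fin.natAdd k b))) =
      vecNorm u * vecNorm v := by
  rw [vecNorm, vecNorm, vecNorm, ← Real.sqrt_mul (by positivity), sum_append]
  simp [mul_pow, Finset.sum_mul_sum]

/-- The tensor product of two rank one operators is rank one with multiplicative norms; bilinearity
gives the rest by a double induction. -/
theorem Nuc.tens {k l : ℕ} {A : Op d k} {B : Op d l} {a b : ℝ} (hA : Nuc A a) (hB : Nuc B b) :
    Nuc (FCS.tens A B) (a * b) := by
  induction hA with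
  | zero => rw [tens_zero_left, zero_mul]; exact .zero
  | rank_one u v =>
    have hb := hB.nonneg
    induction hB with
    | zero => rw [tens_zero_right, mul_zero]; exact .zero
    | rank_one u' v' =>
      have : FCS.tens (vecMulVec u v) (vecMulVec u' v') = vecMulVec
          (fun x => u (fun a => x (Fin.castAdd l a)) * u' (fun b => x (Fin.natAdd k b)))
          (fun x => v (fun a => x (Fin.castAdd l a)) * v' (fun b => x (Fin.natAdd k b))) := by
        ext x y
        simp only [FCS.tens, Matrix.of_apply, vecMulVec_apply]
        ring
      rw [this]
      refine (Nuc.rank_one _ _).mono (le_of_eq ?_)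
      rw [vecNorm_append, vecNorm_append]
      ring
    | add h1 h2 ih1 ih2 =>
      rw [tens_add_right, mul_add]
      exact (ih1 h1.nonneg).add (ih2 h2.nonneg)
    | mono h1 h2 ih =>
      exact (ih h1.nonneg).mono
        (mul_le_mul_of_nonneg_left h2 (mul_nonneg (vecNorm_nonneg _) (vecNorm_nonneg _)))
  | add _ _ ih1 ih2 => rw [tens_add_left, add_mul]; exact ih1.add ih2
  | mono _ h2 ih => exact ih.mono (mul_le_mul_of_nonneg_right h2 hB.nonneg)

end Tensor

/-! ### The algebra of a block -/

section BlockAlg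

variable {d : ℕ} {𝒜 : StarSubalgebra ℂ (Matrix (Fin d) (Fin d) ℂ)}

theorem tensorProd_mem {n : ℕ} {a : Fin n → Matrix (Fin d) (Fin d) ℂ} (ha : ∀ k, a k ∈ 𝒜) :
    tensorProd a ∈ blockAlg 𝒜 n :=
  Submodule.subset_span ⟨a, ha, rfl⟩

theorem one_mem_blockAlg {n : ℕ} : (1 : Op d n) ∈ blockAlg 𝒜 n := by
  rw [← tensorProd_one]
  exact tensorProd_mem fun _ => one_mem 𝒜

theorem tens_mem {k l : ℕ} {A : Op d k} {B : Op d l} (hA : A ∈ blockAlg 𝒜 k)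
    (hB : B ∈ blockAlg 𝒜 l) : tens A B ∈ blockAlg 𝒜 (k + l) := by
  induction hA using Submodule.span_induction with
  | zero => rw [tens_zero_left]; exact zero_mem _
  | add x y _ _ hx hy => rw [tens_add_left]; exact add_mem hx hy
  | smul c x _ hx => rw [tens_smul_left]; exact Submodule.smul_mem _ _ hx
  | mem x hx =>
    obtain ⟨a, ha, rfl⟩ := hx
    induction hB using Submodule.span_induction with
    | zero => rw [tens_zero_right]; exact zero_mem _
    | add x y _ _ hx hy => rw [tens_add_right]; exact add_mem hx hy
    | smul c x _ hx => rw [tens_smul_right]; exact Submodule.smul_mem _ _ hx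
    | mem x hx =>
      obtain ⟨b, hb, rfl⟩ := hx
      rw [← tensorProd_append]
      refine tensorProd_mem fun i => ?_
      refine Fin.addCases (fun i => ?_) (fun i => ?_) i
      · rw [Fin.append_left]; exact ha i
      · rw [Fin.append_right]; exact hb i

variable {κ : Type*} [Fintype κ] [DecidableEq κ] {Z : κ → Matrix (Fin d) (Fin d) ℂ}

omit [Fintype κ] in
theorem IsHSBasis.mem {ι : Type*} {S : Submodule ℂ (Matrix ι ι ℂ)} [Fintype ι]
    {b : κ → Matrix ι ι ℂ} (hb : IsHSBasis S b) (i : κ) : b i ∈ S :=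
  hb.span_eq ▸ Submodule.subset_span ⟨i, rfl⟩

theorem IsHSBasis.expand {ι : Type*} {S : Submodule ℂ (Matrix ι ι ℂ)} [Fintype ι]
    {b : κ → Matrix ι ι ℂ} (hb : IsHSBasis S b) {A : Matrix ι ι ℂ} (hA : A ∈ S) :
    A = ∑ i, (A * b i).trace • b i := by
  rw [← hb.span_eq, Submodule.mem_span_range_iff_exists_fun] at hA
  obtain ⟨c, rfl⟩ := hA
  refine Finset.sum_congr rfl fun i _ => ?_
  congr 1
  simp [Finset.sum_mul, Matrix.trace_sum, hb.orthonormal]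

/-- Traces of elementary tensors factorize over the sites, and expanding every factor of a tensor in
`Z` gives spanning. -/
theorem IsHSBasis.block (hZ : IsHSBasis (Subalgebra.toSubmodule 𝒜.toSubalgebra) Z) (n : ℕ) :
    IsHSBasis (blockAlg 𝒜 n) (fun k : Fin n → κ => tensorProd fun i => Z (k i)) := by
  refine ⟨fun k => ?_, fun k l => ?_, le_antisymm ?_ ?_⟩
  · ext x y
    simp only [tensorProd, Matrix.conjTranspose_apply, Matrix.of_apply, star_prod]
    exact Finset.prod_congr rfl fun i _ => (hZ.isHermitian (k i)).apply _ _
  · simp only [trace_tensorProd_mul_tensorProd, hZ.orthonormal, Finset.prod_ite_zero, funext_iff]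
    simp
  · rw [Submodule.span_le]
    rintro _ ⟨k, rfl⟩
    exact tensorProd_mem fun i => hZ.mem (k i)
  · refine Submodule.span_le.2 ?_
    rintro _ ⟨a, ha, rfl⟩
    have h : tensorProd a = ∑ k : Fin n → κ,
        (∏ i, (a i * Z (k i)).trace) • tensorProd fun i => Z (k i) := by
      ext x y
      simp only [tensorProd, Matrix.of_apply, Matrix.sum_apply, Matrix.smul_apply, smul_eq_mul,
        ← Finset.prod_mul_distrib]
      rw [← Fintype.piFinset_univ, ← Finset.prod_univ_sum (fun _ => Finset.univ)
        (fun i c => (a i * Z c).trace * Z c (x i) (y i))]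
      refine Finset.prod_congr rfl fun i _ => ?_
      conv_lhs => rw [hZ.expand (ha i)]
      simp [Matrix.sum_apply]
    rw [h]
    exact Submodule.sum_mem _ fun k _ => Submodule.smul_mem _ _ (Submodule.subset_span ⟨k, rfl⟩)

end BlockAlg

/-! ### Compressing a functional to a part of a block -/

section Ptr

variable {d : ℕ} {𝒜 : StarSubalgebra ℂ (Matrix (Fin d) (Fin d) ℂ)}

/-- The matrix representing the functional `X ↦ trace (D * (y ⊗ X ⊗ z))`. -/
def ptr {j i l : ℕ} (D : Op d (j + i + l)) (y : Op d j) (z : Op d l) : Op d i :=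
  Matrix.of fun a a' => ∑ p : Fin j → Fin d, ∑ p' : Fin j → Fin d, ∑ q : Fin l → Fin d,
    ∑ q' : Fin l → Fin d, D (Fin.append (Fin.append p a) q) (Fin.append (Fin.append p' a') q') *
      (y p' p * z q' q)

theorem sum_comm₆ {A A' P P' Q Q' : Type*} [Fintype A] [Fintype A'] [Fintype P] [Fintype P']
    [Fintype Q] [Fintype Q'] (f : A → A' → P → P' → Q → Q' → ℂ) :
    ∑ a, ∑ a', ∑ p, ∑ p', ∑ q, ∑ q', f a a' p p' q q' =
      ∑ p, ∑ a, ∑ q, ∑ p', ∑ a', ∑ q', f a a' p p' q q' := by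
  calc _ = ∑ a, ∑ p, ∑ a', ∑ p', ∑ q, ∑ q', f a a' p p' q q' :=
        Finset.sum_congr rfl fun a _ => Finset.sum_comm
    _ = ∑ p, ∑ a, ∑ a', ∑ p', ∑ q, ∑ q', f a a' p p' q q' := Finset.sum_comm
    _ = _ := Finset.sum_congr rfl fun p _ => Finset.sum_congr rfl fun a _ => by
      rw [Finset.sum_congr rfl fun a' _ => Finset.sum_comm, Finset.sum_comm]
      exact Finset.sum_congr rfl fun q _ => Finset.sum_comm

theorem sum_comm₅ {C P P' Q Q' : Type*} [Fintype C] [Fintype P] [Fintype P']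
    [Fintype Q] [Fintype Q'] (f : P → P' → Q → Q' → C → ℂ) :
    ∑ p, ∑ p', ∑ q, ∑ q', ∑ c, f p p' q q' c = ∑ c, ∑ p', ∑ q', ∑ p, ∑ q, f p p' q q' c := by
  calc _ = ∑ p, ∑ p', ∑ q', ∑ q, ∑ c, f p p' q q' c :=
        Finset.sum_congr rfl fun p _ => Finset.sum_congr rfl fun p' _ => Finset.sum_comm
    _ = ∑ p', ∑ q', ∑ p, ∑ q, ∑ c, f p p' q q' c := by
      rw [Finset.sum_comm]
      exact Finset.sum_congr rfl fun p' _ => Finset.sum_comm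
    _ = ∑ p', ∑ q', ∑ c, ∑ p, ∑ q, f p p' q q' c := by
      refine Finset.sum_congr rfl fun p' _ => Finset.sum_congr rfl fun q' _ => ?_
      rw [Finset.sum_congr rfl fun p _ => Finset.sum_comm, Finset.sum_comm]
    _ = ∑ p', ∑ c, ∑ q', ∑ p, ∑ q, f p p' q q' c :=
      Finset.sum_congr rfl fun p' _ => Finset.sum_comm
    _ = _ := Finset.sum_comm

theorem trace_ptr_mul {j i l : ℕ} (D : Op d (j + i + l)) (y : Op d j) (z : Op d l) (X : Op d i) :
    (ptr D y z * X).trace = (D * tens (tens y X) z).trace := by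
  simp only [Matrix.trace, Matrix.diag, Matrix.mul_apply, sum_append, tens_append, ptr,
    Matrix.of_apply, Finset.sum_mul]
  refine (sum_comm₆ _).trans ?_
  refine Finset.sum_congr rfl fun p _ => Finset.sum_congr rfl fun a _ =>
    Finset.sum_congr rfl fun q _ => Finset.sum_congr rfl fun p' _ =>
    Finset.sum_congr rfl fun a' _ => Finset.sum_congr rfl fun q' _ => ?_
  ring

/-- Needed because identities between operators are tested only against the block algebra, which
determines an operator only if it lies in that algebra. -/
theorem ptr_mem {j i l : ℕ} {D : Op d (j + i + l)} (hD : D ∈ blockAlg 𝒜 (j + i + l)) (y : Op d j)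
    (z : Op d l) : ptr D y z ∈ blockAlg 𝒜 i := by
  induction hD using Submodule.span_induction with
  | zero =>
    convert zero_mem (blockAlg 𝒜 i)
    ext; simp [ptr]
  | add D D' _ _ h h' =>
    convert add_mem h h'
    ext; simp [ptr, add_mul, Finset.sum_add_distrib]
  | smul c D _ h =>
    convert Submodule.smul_mem _ c h
    ext; simp [ptr, Finset.mul_sum, mul_assoc]
  | mem D hD =>
    obtain ⟨a, ha, rfl⟩ := hD
    have h : ptr (tensorProd a) y z =
        (∑ p : Fin j → Fin d, ∑ p' : Fin j → Fin d, ∑ q : Fin l → Fin d, ∑ q' : Fin l → Fin d,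
          (∏ k, a (Fin.castAdd l (Fin.castAdd i k)) (p k) (p' k)) *
          (∏ k, a (Fin.natAdd (j + i) k) (q k) (q' k)) * (y p' p * z q' q)) •
        tensorProd fun k : Fin i => a (Fin.castAdd l (Fin.natAdd j k)) := by
      ext x x'
      simp only [ptr, tensorProd, Matrix.of_apply, Matrix.smul_apply, smul_eq_mul, Finset.sum_mul,
        Fin.prod_univ_add, Fin.append_left, Fin.append_right]
      refine Finset.sum_congr rfl fun p _ => Finset.sum_congr rfl fun p' _ =>
        Finset.sum_congr rfl fun q _ => Finset.sum_congr rfl fun q' _ => ?_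
      ring
    rw [h]
    exact Submodule.smul_mem _ _ (tensorProd_mem fun k => ha _)

/-- With D = SᴴS, both `y` and `z` can be absorbed into the factor `Sᴴ`. What remains is a product
of two matrices, and Hilbert-Schmidt norms bound its trace norm without any factor depending on the
dimension of the middle block. -/
theorem nuc_ptr {j i l : ℕ} {D : Op d (j + i + l)} (hD : D.PosSemidef) (htr : D.trace = 1)
    (y : Op d j) (z : Op d l) : Nuc (ptr D y z) (hsNorm y * hsNorm z) := by
  obtain ⟨N, S, rfl, hS⟩ := exists_eq_conjTranspose_mul_self hD htr
  let B : Matrix (Fin i → Fin d) (Fin N × (Fin j → Fin d) × (Fin l → Fin d)) ℂ :=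
    Matrix.of fun a c => ∑ p, ∑ q, star (S c.1 (Fin.append (Fin.append p a) q)) *
      (y c.2.1 p * z c.2.2 q)
  let C : Matrix (Fin N × (Fin j → Fin d) × (Fin l → Fin d)) (Fin i → Fin d) ℂ :=
    Matrix.of fun c a => S c.1 (Fin.append (Fin.append c.2.1 a) c.2.2)
  have h : ptr (Sᴴ * S) y z = B * C := by
    ext a a'
    simp only [ptr, B, C, Matrix.of_apply, Matrix.mul_apply, Matrix.conjTranspose_apply,
      Finset.sum_mul, Fintype.sum_prod_type]
    refine (sum_comm₅ _).trans ?_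
    refine Finset.sum_congr rfl fun c _ => Finset.sum_congr rfl fun p' _ =>
      Finset.sum_congr rfl fun q' _ => Finset.sum_congr rfl fun p _ =>
      Finset.sum_congr rfl fun q _ => ?_
    ring
  have hC : hsNorm C = 1 := by
    rw [← hS, hsNorm, hsNorm]
    congr 1
    simp only [C, Matrix.of_apply, Fintype.sum_prod_type, sum_append]
    refine Finset.sum_congr rfl fun c _ => Finset.sum_congr rfl fun p _ => ?_
    exact Finset.sum_comm
  -- Regrouping the indices writes `B` as a product of a reshaped `S` and a reshaped `y ⊗ z`.
  have hB : hsNorm B ≤ hsNorm y * hsNorm z := by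
    let T : Matrix (Fin N × (Fin i → Fin d)) ((Fin j → Fin d) × (Fin l → Fin d)) ℂ :=
      Matrix.of fun c b => star (S c.1 (Fin.append (Fin.append b.1 c.2) b.2))
    let W : Matrix ((Fin j → Fin d) × (Fin l → Fin d)) ((Fin j → Fin d) × (Fin l → Fin d)) ℂ :=
      Matrix.of fun b b' => y b'.1 b.1 * z b'.2 b.2
    have hBT : hsNorm B = hsNorm (T * W) := by
      rw [hsNorm, hsNorm]
      congr 1
      simp only [Fintype.sum_prod_type, B, T, W, Matrix.of_apply, Matrix.mul_apply]
      exact Finset.sum_comm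
    have hT : hsNorm T = 1 := by
      rw [← hS, hsNorm, hsNorm]
      congr 1
      simp only [T, Matrix.of_apply, Fintype.sum_prod_type, sum_append, norm_star]
      refine Finset.sum_congr rfl fun c _ => Finset.sum_comm
    have hW : hsNorm W = hsNorm y * hsNorm z := by
      rw [← hsNorm_tens, hsNorm, hsNorm, Finset.sum_comm]
      simp only [W, Matrix.of_apply, Fintype.sum_prod_type, sum_append, tens_append]
    rw [hBT]
    refine (hsNorm_mul_le T W).trans (le_of_eq ?_)
    rw [hT, hW, one_mul]
  rw [h]
  refine (Nuc.mul B C).mono ?_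
  rw [hC, mul_one]
  exact hB

end Ptr

variable {d : ℕ} {𝒜 : StarSubalgebra ℂ (Matrix (Fin d) (Fin d) ℂ)}

/-! ### Expectations -/

/-- The expectation of an operator on a block of `n` sites. -/
def TIState.ev (ω : TIState 𝒜) (n : ℕ) : Op d n →ₗ[ℂ] ℂ :=
  Matrix.traceLinearMap _ ℂ ℂ ∘ₗ LinearMap.mulLeft ℂ (ω.dens n)

theorem TIState.ev_apply (ω : TIState 𝒜) {n : ℕ} (X : Op d n) :
    ω.ev n X = (ω.dens n * X).trace := rfl

theorem TIState.ev_submatrix (ω : TIState 𝒜) {n n' : ℕ} (h : n = n') (X : Op d n') :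
    ω.ev n (X.submatrix (Equiv.arrowCongr (finCongr h) (Equiv.refl _))
      (Equiv.arrowCongr (finCongr h) (Equiv.refl _))) = ω.ev n' X := by
  subst h; rfl

theorem TIState.ev_assoc (ω : TIState 𝒜) {k l n : ℕ} (A : Op d k) (B : Op d l) (C : Op d n) :
    ω.ev (k + l + n) (tens (tens A B) C) = ω.ev (k + (l + n)) (tens A (tens B C)) := by
  rw [tens_assoc, ω.ev_submatrix (add_assoc k l n)]

theorem TIState.ev_assoc_inner (ω : TIState 𝒜) {j k l n : ℕ} (A : Op d j) (B : Op d k)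
    (C : Op d l) (D : Op d n) :
    ω.ev (j + (k + l) + n) (tens (tens A (tens B C)) D) =
      ω.ev (j + k + (l + n)) (tens (tens A B) (tens C D)) := by
  have h : j + (k + l) = j + k + l := (add_assoc j k l).symm
  have h' : j + (k + l) + n = j + k + l + n := by rw [h]
  rw [← ω.ev_assoc, ← ω.ev_submatrix h']
  congr 1
  ext x y
  have h1 : ∀ (x : Fin (j + (k + l) + n) → Fin d) (b : Fin n),
      Equiv.arrowCongr (finCongr h') (Equiv.refl _) x (Fin.natAdd (j + k + l) b) =
        x (Fin.natAdd (j + (k + l)) b) :=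
    fun x b => congrArg x (Fin.ext (by simp [add_assoc]))
  have h2 : ∀ (x : Fin (j + (k + l) + n) → Fin d) (b : Fin l),
      Equiv.arrowCongr (finCongr h') (Equiv.refl _) x (Fin.castAdd n (Fin.natAdd (j + k) b)) =
        x (Fin.castAdd n (Fin.natAdd j (Fin.natAdd k b))) :=
    fun x b => congrArg x (Fin.ext (by simp [add_assoc]))
  simp only [tens, Matrix.of_apply, Matrix.submatrix_apply, h1, h2, ← mul_assoc]
  rfl

variable {κ : Type*} [Fintype κ] [DecidableEq κ] {Z : κ → Matrix (Fin d) (Fin d) ℂ}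

/-- The product basis consists of elementary tensors, each of which splits at the cut, so testing on
products determines all coefficients. -/
theorem eq_of_trace_mul_tens (hZ : IsHSBasis (Subalgebra.toSubmodule 𝒜.toSubalgebra) Z) {k l : ℕ}
    {A B : Op d (k + l)} (hA : A ∈ blockAlg 𝒜 (k + l)) (hB : B ∈ blockAlg 𝒜 (k + l))
    (h : ∀ U ∈ blockAlg 𝒜 k, ∀ V ∈ blockAlg 𝒜 l,
      (A * tens U V).trace = (B * tens U V).trace) : A = B := by
  rw [(hZ.block _).expand hA, (hZ.block _).expand hB]
  refine Finset.sum_congr rfl fun w _ => ?_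
  have hw : (fun i => Z (w i)) = Fin.append (fun i => Z (w (Fin.castAdd l i)))
      (fun i => Z (w (Fin.natAdd k i))) := by
    funext i
    refine Fin.addCases (fun i => ?_) (fun i => ?_) i <;> simp
  rw [hw, tensorProd_append, h _ (tensorProd_mem fun i => hZ.mem _) _
    (tensorProd_mem fun i => hZ.mem _)]

theorem eq_of_trace_mul (hZ : IsHSBasis (Subalgebra.toSubmodule 𝒜.toSubalgebra) Z) {k : ℕ}
    {A B : Op d k} (hA : A ∈ blockAlg 𝒜 k) (hB : B ∈ blockAlg 𝒜 k)
    (h : ∀ U ∈ blockAlg 𝒜 k, (A * U).trace = (B * U).trace) : A = B := by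
  rw [(hZ.block _).expand hA, (hZ.block _).expand hB]
  refine Finset.sum_congr rfl fun w _ => ?_
  rw [h _ (tensorProd_mem fun i => hZ.mem _)]

/-! ### Factorization of correlations across a cut -/

/-- On elementary tensors the product of the operators `E` splits at the cut into a functional (`ρ`
times the left factors) applied to a vector (the right factors times `e`). Expansion in the product
bases extends this linearly. -/
theorem Realization.exists_factorization {ω : TIState 𝒜} {m : ℕ}
    (R : Realization ω (Fin m → ℂ))
    (hZ : IsHSBasis (Subalgebra.toSubmodule 𝒜.toSubalgebra) Z) :
    ∃ f g : ∀ n, Op d n → Fin m → ℂ, ∀ k l, ∀ A ∈ blockAlg 𝒜 k, ∀ B ∈ blockAlg 𝒜 l,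
      ω.ev (k + l) (tens A B) = f k A ⬝ᵥ g l B := by
  let a : κ → 𝒜 := fun i => ⟨Z i, hZ.mem i⟩
  let P : ∀ {n : ℕ}, (Fin n → κ) → Module.End ℂ (Fin m → ℂ) :=
    fun w => (List.ofFn fun i => R.E (a (w i))).prod
  refine ⟨fun n A j => ∑ w : Fin n → κ, (A * tensorProd fun i => Z (w i)).trace *
      R.rho (P w (Pi.single j 1)),
    fun n B => ∑ w : Fin n → κ, (B * tensorProd fun i => Z (w i)).trace • P w R.e,
    fun k l A hA B hB => ?_⟩
  have hprod : ∀ (w : Fin k → κ) (v : Fin l → κ),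
      ω.ev (k + l) (tens (tensorProd fun i => Z (w i)) (tensorProd fun i => Z (v i))) =
        (fun j => R.rho (P w (Pi.single j 1))) ⬝ᵥ P v R.e := by
    intro w v
    have h := R.expect (k + l) (Fin.append (fun i => a (w i)) (fun i => a (v i)))
    have h2 : (fun i => ((Fin.append (fun i => a (w i)) (fun i => a (v i)) i : 𝒜) :
        Matrix (Fin d) (Fin d) ℂ)) = Fin.append (fun i => Z (w i)) (fun i => Z (v i)) := by
      funext i
      refine Fin.addCases (fun i => ?_) (fun i => ?_) i <;> simp [a]
    have h3 : (fun i => R.E (Fin.append (fun i => a (w i)) (fun i => a (v i)) i)) =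
        Fin.append (fun i => R.E (a (w i))) (fun i => R.E (a (v i))) := by
      funext i
      refine Fin.addCases (fun i => ?_) (fun i => ?_) i <;> simp
    rw [h2, tensorProd_append, h3, List.ofFn_fin_append, List.prod_append] at h
    rw [TIState.ev_apply, h, Module.End.mul_apply]
    have h4 := LinearMap.pi_apply_eq_sum_univ (R.rho ∘ₗ P w) (P v R.e)
    simp only [LinearMap.comp_apply] at h4
    refine h4.trans ?_
    simp only [dotProduct, smul_eq_mul]
    refine Finset.sum_congr rfl fun j _ => ?_
    rw [mul_comm]
    congr 4
    funext i
    simp [Pi.single_apply, eq_comm]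
  conv_lhs => rw [(hZ.block k).expand hA, (hZ.block l).expand hB]
  simp only [tens_sum_left, tens_sum_right, tens_smul_left, tens_smul_right, map_sum, map_smul,
    hprod, smul_eq_mul, dotProduct, Finset.sum_apply, Pi.smul_apply, Finset.mul_sum, Finset.sum_mul]
  rw [Finset.sum_congr rfl fun v _ => Finset.sum_comm, Finset.sum_comm]
  refine Finset.sum_congr rfl fun j _ => Finset.sum_congr rfl fun v _ =>
    Finset.sum_congr rfl fun w _ => ?_
  ring

/-- Operators `y` and `x` on blocks to the left and to the right of a cut through which all
correlations across the cut factorize. -/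
structure DualFrame (ω : TIState 𝒜) {s : ℕ} {ν : Type*} [Fintype ν] [DecidableEq ν]
    (y x : ν → Op d s) (g : ℝ) : Prop where
  y_mem : ∀ β, y β ∈ blockAlg 𝒜 s
  x_mem : ∀ β, x β ∈ blockAlg 𝒜 s
  y_norm : ∀ β, hsNorm (y β) ≤ 1
  x_norm : ∀ β, hsNorm (x β) ≤ g
  dual : ∀ α β, ω.ev (s + s) (tens (y α) (x β)) = if α = β then 1 else 0
  factor : ∀ k l, ∀ A ∈ blockAlg 𝒜 k, ∀ B ∈ blockAlg 𝒜 l,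
    ω.ev (k + l) (tens A B) = ∑ β, ω.ev (k + s) (tens A (x β)) * ω.ev (s + l) (tens (y β) B)

/-! ### Propagation of errors along the chain in trace norm -/

section Stability

variable {ω : TIState 𝒜} {s : ℕ} {ν : Type*} [Fintype ν] [DecidableEq ν] {y x : ν → Op d s}
  {g : ℝ}

/-- The transfer operators of the realization attached to a dual frame. -/
def transfer (ω : TIState 𝒜) (y x : ν → Op d s) (β γ : ν) : Op d 1 :=
  ptr (ω.dens (s + 1 + s)) (y β) (x γ)

/-- The functional `X ↦ ω (X ⊗ x β)`. -/
def leftOp (ω : TIState 𝒜) (x : ν → Op d s) (n : ℕ) (β : ν) : Op d n :=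
  ptr (ω.dens (0 + n + s)) 1 (x β)

/-- The functional `X ↦ ω (y β ⊗ X ⊗ z)`. -/
def rightOp (ω : TIState 𝒜) (y : ν → Op d s) (i : ℕ) (β : ν) {l : ℕ} (z : Op d l) : Op d i :=
  ptr (ω.dens (s + i + l)) (y β) z

omit [Fintype ν] [DecidableEq ν] in
theorem trace_transfer_mul (β γ : ν) (X : Op d 1) :
    (transfer ω y x β γ * X).trace = ω.ev (s + 1 + s) (tens (tens (y β) X) (x γ)) :=
  trace_ptr_mul _ _ _ _

omit [Fintype ν] [DecidableEq ν] in
theorem trace_rightOp_mul {i l : ℕ} (β : ν) (z : Op d l) (X : Op d i) :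
    (rightOp ω y i β z * X).trace = ω.ev (s + i + l) (tens (tens (y β) X) z) :=
  trace_ptr_mul _ _ _ _

theorem DualFrame.trace_leftOp_mul (h : DualFrame ω y x g) {n : ℕ} (β : ν) {X : Op d n}
    (hX : X ∈ blockAlg 𝒜 n) : (leftOp ω x n β * X).trace = ω.ev (n + s) (tens X (x β)) := by
  rw [leftOp, trace_ptr_mul, ← TIState.ev_apply, TIState.ev_assoc, TIState.ev_apply,
    TIState.ev_apply, ω.left_compat _ _ _ (tens_mem hX (h.x_mem β))]

omit [Fintype ν] [DecidableEq ν] in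
theorem nuc_leftOp {n : ℕ} (β : ν) : Nuc (leftOp ω x n β) (hsNorm (x β)) := by
  have := nuc_ptr (ω.posSemidef (0 + n + s)) (ω.trace_one _) (1 : Op d 0) (x β)
  rw [hsNorm_one] at this
  exact this.mono (by simp)

theorem DualFrame.nuc_rightOp (h : DualFrame ω y x g) {i l : ℕ} (β : ν) (z : Op d l) :
    Nuc (rightOp ω y i β z) (hsNorm z) := by
  refine (nuc_ptr (ω.posSemidef (s + i + l)) (ω.trace_one _) (y β) z).mono ?_
  simpa using mul_le_mul_of_nonneg_right (h.y_norm β) (hsNorm_nonneg z)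

/-- The resolution of correlations is inserted at the cut just before the last site. -/
theorem DualFrame.leftOp_succ (h : DualFrame ω y x g)
    (hZ : IsHSBasis (Subalgebra.toSubmodule 𝒜.toSubalgebra) Z) (n : ℕ) (γ : ν) :
    leftOp ω x (n + 1) γ = ∑ β, tens (leftOp ω x n β) (transfer ω y x β γ) := by
  refine eq_of_trace_mul_tens hZ (ptr_mem (ω.mem _) _ _)
    (Submodule.sum_mem _ fun β _ => tens_mem (ptr_mem (ω.mem _) _ _) (ptr_mem (ω.mem _) _ _))
    fun U hU V hV => ?_
  rw [h.trace_leftOp_mul _ (tens_mem hU hV), Finset.sum_mul, Matrix.trace_sum, ω.ev_assoc,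
    h.factor _ _ _ hU _ (tens_mem hV (h.x_mem γ))]
  refine Finset.sum_congr rfl fun β _ => ?_
  rw [trace_tens_mul_tens, h.trace_leftOp_mul _ hU, trace_transfer_mul, ω.ev_assoc]

/-- The resolution is inserted at the cut just after the first site of the middle block. -/
theorem DualFrame.rightOp_succ (h : DualFrame ω y x g)
    (hZ : IsHSBasis (Subalgebra.toSubmodule 𝒜.toSubalgebra) Z) (i : ℕ) (β : ν) {l : ℕ}
    {z : Op d l} (hz : z ∈ blockAlg 𝒜 l) :
    rightOp ω y (1 + i) β z = ∑ γ, tens (transfer ω y x β γ) (rightOp ω y i γ z) := by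
  refine eq_of_trace_mul_tens hZ (ptr_mem (ω.mem _) _ _)
    (Submodule.sum_mem _ fun β _ => tens_mem (ptr_mem (ω.mem _) _ _) (ptr_mem (ω.mem _) _ _))
    fun U hU V hV => ?_
  rw [trace_rightOp_mul, Finset.sum_mul, Matrix.trace_sum, ω.ev_assoc_inner,
    h.factor _ _ _ (tens_mem (h.y_mem β) hU) _ (tens_mem hV hz)]
  refine Finset.sum_congr rfl fun γ _ => ?_
  rw [trace_tens_mul_tens, trace_transfer_mul, trace_rightOp_mul, ω.ev_assoc (y γ)]

theorem eq_trace_smul_one (A : Op d 0) : A = A.trace • (1 : Op d 0) := by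
  ext a b
  rw [Subsingleton.elim b a]
  simp [Matrix.trace, Subsingleton.elim default a]

omit [Fintype ν] [DecidableEq ν] in
theorem rightOp_zero (β : ν) {l : ℕ} (z : Op d l) :
    rightOp ω y 0 β z = ω.ev (s + l) (tens (y β) z) • (1 : Op d 0) := by
  rw [eq_trace_smul_one (rightOp ω y 0 β z), ← Matrix.mul_one (rightOp ω y 0 β z),
    trace_rightOp_mul, tens_one_zero]
  rfl

/-- The resolution is used at the right end of the block, with an empty block beyond the cut. -/
theorem DualFrame.dens_eq (h : DualFrame ω y x g)
    (hZ : IsHSBasis (Subalgebra.toSubmodule 𝒜.toSubalgebra) Z) (n : ℕ) :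
    ω.dens n = ∑ β, ω.ev s (y β) • leftOp ω x n β := by
  refine eq_of_trace_mul hZ (ω.mem n)
    (Submodule.sum_mem _ fun β _ => Submodule.smul_mem _ _ (ptr_mem (ω.mem _) _ _)) fun U hU => ?_
  have := h.factor n 0 U hU 1 one_mem_blockAlg
  simp only [tens_one_zero] at this
  rw [Finset.sum_mul, Matrix.trace_sum, ← TIState.ev_apply]
  refine this.trans (Finset.sum_congr rfl fun β _ => ?_)
  rw [smul_mul_assoc, Matrix.trace_smul, h.trace_leftOp_mul _ hU, smul_eq_mul, mul_comm]
  rfl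

/-- A bound for the trace norms of all contractions of the family `E` with parts of the state. -/
def ContractBound (ω : TIState 𝒜) (y : ν → Op d s) {n : ℕ} (E : ν → Op d n) (c : ℝ) : Prop :=
  ∀ (i l : ℕ) (z : Op d l), z ∈ blockAlg 𝒜 l →
    Nuc (∑ β, tens (E β) (rightOp ω y i β z)) (c * hsNorm z)

omit [DecidableEq ν] in
theorem ContractBound.nuc {n : ℕ} {E : ν → Op d n} {c : ℝ} (hE : ContractBound ω y E c) {l : ℕ}
    {z : Op d l} (hz : z ∈ blockAlg 𝒜 l) :
    Nuc (∑ β, ω.ev (s + l) (tens (y β) z) • E β) (c * hsNorm z) := by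
  have := hE 0 l z hz
  simp only [rightOp_zero, tens_smul_right, tens_one_zero] at this
  exact this

/-- Contraction with `z = x α` and an empty middle block isolates the member `α` by duality, at the
price of the norm of `x α`. -/
theorem ContractBound.nuc_apply {n : ℕ} {E : ν → Op d n} {c : ℝ} (h : DualFrame ω y x g)
    (hE : ContractBound ω y E c) (hc : 0 ≤ c) (α : ν) : Nuc (E α) (c * g) := by
  have := hE.nuc (h.x_mem α)
  simp only [h.dual, ite_smul, one_smul, zero_smul, Finset.sum_ite_eq', Finset.mem_univ,
    if_true] at this
  exact this.mono (mul_le_mul_of_nonneg_left (h.x_norm α) hc)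

/-- The appended exact transfer operator merges with the remainder into a remainder one site longer,
which the hypothesis already covers. This is why the constant does not deteriorate. -/
theorem ContractBound.transfer {n : ℕ} {E : ν → Op d n} {c : ℝ} (h : DualFrame ω y x g)
    (hZ : IsHSBasis (Subalgebra.toSubmodule 𝒜.toSubalgebra) Z) (hE : ContractBound ω y E c) :
    ContractBound ω y (fun γ => ∑ β, tens (E β) (FCS.transfer ω y x β γ)) c := by
  intro i l z hz
  -- The two bracketings of `n + 1 + i` sites differ by a relabelling, under which the bound is
  -- invariant.
  have key := (hE (1 + i) l z hz).submatrix
    (Equiv.arrowCongr (finCongr (add_assoc n 1 i)) (Equiv.refl (Fin d)))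
  convert key using 1
  simp only [h.rightOp_succ hZ i _ hz, tens_sum_left, tens_sum_right, tens_assoc]
  rw [Finset.sum_comm]
  ext a b
  simp [Matrix.sum_apply]

theorem ContractBound.of_nuc {n : ℕ} {E : ν → Op d n} {c : ν → ℝ} (h : DualFrame ω y x g)
    (hE : ∀ β, Nuc (E β) (c β)) : ContractBound ω y E (∑ β, c β) := by
  intro i l z hz
  rw [Finset.sum_mul]
  exact Nuc.sum _ fun β _ => (hE β).tens (h.nuc_rightOp β z)

/-- The row vectors `ρ K ⋯ K` (with `n` factors) of a matrix product operator. -/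
def mpoRow (r : ν → ℂ) (K : ν → ν → Op d 1) : ∀ n : ℕ, ν → Op d n
  | 0, β => r β • 1
  | n + 1, γ => ∑ β, tens (mpoRow r K n β) (K β γ)

omit [DecidableEq ν] in
theorem mpoRow_succ (r : ν → ℂ) (K : ν → ν → Op d 1) (n : ℕ) (γ : ν) :
    mpoRow r K (n + 1) γ = ∑ β, tens (mpoRow r K n β) (K β γ) := rfl

theorem nuc_of_hsNorm_one_site (A : Op d 1) : Nuc A (√d * hsNorm A) := by
  have := Nuc.of_hsNorm A
  simpa using this

theorem nuc_one_zero : Nuc (1 : Op d 0) 1 := by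
  have := Nuc.of_hsNorm (1 : Op d 0)
  rw [hsNorm_one] at this
  simpa using this

/-- The error after one more site is the old error followed by the exact transfer operator, plus the
perturbed row followed by the error of the new transfer operator. If `c` bounds the old error, the
new bound is c + θ (1 + c), so 1 + c is multiplied by 1 + θ. -/
theorem DualFrame.contractBound_mpoRow_sub (h : DualFrame ω y x g) (hg : 0 ≤ g)
    (hZ : IsHSBasis (Subalgebra.toSubmodule 𝒜.toSubalgebra) Z)
    {r : ν → ℂ} {K : ν → ν → Op d 1} {δr δK : ℝ}
    (hr : ∑ β, ‖r β - ω.ev s (x β)‖ ≤ δr)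
    (hK : ∑ β, ∑ γ, hsNorm (K β γ - FCS.transfer ω y x β γ) ≤ δK) (n : ℕ) :
    ContractBound ω y (fun β => mpoRow r K n β - leftOp ω x n β)
      ((1 + g * √d * δK) ^ n * (1 + δr) - 1) := by
  have hδr : 0 ≤ δr := (Finset.sum_nonneg fun _ _ => norm_nonneg _).trans hr
  have hδK : 0 ≤ δK := (Finset.sum_nonneg fun _ _ => Finset.sum_nonneg fun _ _ =>
    hsNorm_nonneg _).trans hK
  set θ := g * √d * δK with hθ
  have hθ0 : 0 ≤ θ := by positivity
  induction n with
  | zero =>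
    have h0 : ∀ β, Nuc (mpoRow r K 0 β - leftOp ω x 0 β) ‖r β - ω.ev s (x β)‖ := by
      intro β
      have h1 : leftOp ω x 0 β = ω.ev s (x β) • (1 : Op d 0) := by
        rw [eq_trace_smul_one (leftOp ω x 0 β), ← Matrix.mul_one (leftOp ω x 0 β),
          h.trace_leftOp_mul _ one_mem_blockAlg, TIState.ev_apply, TIState.ev_apply,
          ω.left_compat _ _ _ (h.x_mem β)]
      rw [h1, mpoRow, ← sub_smul]
      simpa using nuc_one_zero.smul (r β - ω.ev s (x β))
    intro i l z hz
    refine (ContractBound.of_nuc h h0 i l z hz).mono ?_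
    refine mul_le_mul_of_nonneg_right ?_ (hsNorm_nonneg z)
    simpa using hr
  | succ n ih =>
    set c := (1 + θ) ^ n * (1 + δr) - 1 with hc
    have hc0 : 0 ≤ c := by
      have : 1 ≤ (1 + θ) ^ n * (1 + δr) :=
        one_le_mul_of_one_le_of_one_le (one_le_pow₀ (by linarith)) (by linarith)
      linarith
    -- The error contributes `c * g` and the exact row operator `leftOp` at most `g`.
    have hrow : ∀ β, Nuc (mpoRow r K n β) ((1 + c) * g) := by
      intro β
      have := (ih.nuc_apply h hc0 β).add
        ((nuc_leftOp (n := n) (ω := ω) (x := x) β).mono (h.x_norm β))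
      rw [sub_add_cancel] at this
      exact this.mono (by linarith)
    -- The fresh error sits on one site, where passing from Hilbert-Schmidt to trace norm costs √d.
    have h2 : ContractBound ω y (fun γ => ∑ β, tens (mpoRow r K n β)
        (K β γ - FCS.transfer ω y x β γ)) (θ * (1 + c)) := by
      intro i l z hz
      refine (ContractBound.of_nuc h (c := fun γ => ∑ β, (1 + c) * g *
        (√d * hsNorm (K β γ - FCS.transfer ω y x β γ))) (fun γ => Nuc.sum _ fun β _ =>
        (hrow β).tens (nuc_of_hsNorm_one_site _)) i l z hz).mono ?_
      refine mul_le_mul_of_nonneg_right ?_ (hsNorm_nonneg z)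
      rw [Finset.sum_comm]
      simp only [← Finset.mul_sum]
      calc (1 + c) * g * (√d * ∑ β, ∑ γ, hsNorm (K β γ - FCS.transfer ω y x β γ))
          ≤ (1 + c) * g * (√d * δK) := by gcongr
        _ = θ * (1 + c) := by rw [hθ]; ring
    intro i l z hz
    have h3 := (ih.transfer h hZ i l z hz).add (h2 i l z hz)
    convert h3 using 1
    · rw [← Finset.sum_add_distrib]
      refine Finset.sum_congr rfl fun γ _ => ?_
      show tens (mpoRow r K (n + 1) γ - leftOp ω x (n + 1) γ) _ = _
      rw [← tens_add_left, ← Finset.sum_add_distrib, mpoRow_succ, h.leftOp_succ hZ,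
        ← Finset.sum_sub_distrib]
      congr 1
      refine Finset.sum_congr rfl fun β _ => ?_
      rw [tens_sub_left, tens_sub_right]
      abel
    · rw [hc]; ring

/-- The exact column closes the row errors without loss; the error of the column meets the perturbed
row, whose members are bounded by (1 + c) g. -/
theorem DualFrame.nuc_mpo_sub_dens (h : DualFrame ω y x g) (hg : 0 ≤ g)
    (hZ : IsHSBasis (Subalgebra.toSubmodule 𝒜.toSubalgebra) Z)
    {r e : ν → ℂ} {K : ν → ν → Op d 1} {δr δK δe : ℝ}
    (hr : ∑ β, ‖r β - ω.ev s (x β)‖ ≤ δr)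
    (hK : ∑ β, ∑ γ, hsNorm (K β γ - FCS.transfer ω y x β γ) ≤ δK)
    (he : ∑ β, ‖e β - ω.ev s (y β)‖ ≤ δe) (n : ℕ) :
    Nuc (∑ β, e β • mpoRow r K n β - ω.dens n)
      ((1 + g * √d * δK) ^ n * (1 + δr) * (1 + g * δe) - 1) := by
  have hδr : 0 ≤ δr := (Finset.sum_nonneg fun _ _ => norm_nonneg _).trans hr
  have hδK : 0 ≤ δK := (Finset.sum_nonneg fun _ _ => Finset.sum_nonneg fun _ _ =>
    hsNorm_nonneg _).trans hK
  have hE := h.contractBound_mpoRow_sub hg hZ hr hK n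
  set c := (1 + g * √d * δK) ^ n * (1 + δr) - 1 with hc
  have hc0 : 0 ≤ c := by
    have : 1 ≤ (1 + g * √d * δK) ^ n * (1 + δr) :=
      one_le_mul_of_one_le_of_one_le (one_le_pow₀ (le_add_of_nonneg_right (by positivity)))
        (by linarith)
    linarith
  have hrow : ∀ β, Nuc (mpoRow r K n β) ((1 + c) * g) := by
    intro β
    have := (hE.nuc_apply h hc0 β).add
        ((nuc_leftOp (n := n) (ω := ω) (x := x) β).mono (h.x_norm β))
    rw [sub_add_cancel] at this
    exact this.mono (by linarith)
  -- Taking `z = 1` on the empty block turns the contraction into the exact column.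
  have h1 : Nuc (∑ β, ω.ev s (y β) • (mpoRow r K n β - leftOp ω x n β)) c := by
    have := hE.nuc (l := 0) (z := 1) one_mem_blockAlg
    simp only [tens_one_zero, hsNorm_one] at this
    simpa using this
  have h2 : Nuc (∑ β, (e β - ω.ev s (y β)) • mpoRow r K n β)
      (∑ β, ‖e β - ω.ev s (y β)‖ * ((1 + c) * g)) :=
    Nuc.sum _ fun β _ => (hrow β).smul _
  have h3 := h1.add h2
  rw [← Finset.sum_add_distrib] at h3
  rw [h.dens_eq hZ n, ← Finset.sum_sub_distrib]
  refine Nuc.mono (a := c + ∑ β, ‖e β - ω.ev s (y β)‖ * ((1 + c) * g)) ?_ ?_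
  · convert h3 using 1
    refine Finset.sum_congr rfl fun β _ => ?_
    rw [smul_sub, sub_smul]
    abel
  · rw [← Finset.sum_mul]
    calc c + (∑ β, ‖e β - ω.ev s (y β)‖) * ((1 + c) * g) ≤ c + δe * ((1 + c) * g) := by gcongr
      _ = _ := by rw [hc]; ring

end Stability

/-! ### Linear algebra of the truncated singular value decomposition -/

theorem IsMoorePenrose.unique {ι κ : Type*} [Fintype ι] [Fintype κ] {A : Matrix ι κ ℂ}
    {B C : Matrix κ ι ℂ} (hB : IsMoorePenrose A B) (hC : IsMoorePenrose A C) : B = C := by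
  have h1 : A * B = A * C := by
    calc A * B = (A * B)ᴴ := hB.isHermitian_left.eq.symm
      _ = (A * C * (A * B))ᴴ := by rw [← Matrix.mul_assoc, hC.mul_mul_left]
      _ = A * B * (A * C) := by
        rw [conjTranspose_mul, hB.isHermitian_left.eq, hC.isHermitian_left.eq]
      _ = A * C := by rw [← Matrix.mul_assoc, hB.mul_mul_left]
  have h2 : B * A = C * A := by
    calc B * A = (B * A)ᴴ := hB.isHermitian_right.eq.symm
      _ = (B * A * (C * A))ᴴ := by
        rw [Matrix.mul_assoc, ← Matrix.mul_assoc A, hC.mul_mul_left]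
      _ = C * A * (B * A) := by
        rw [conjTranspose_mul, hB.isHermitian_right.eq, hC.isHermitian_right.eq]
      _ = C * A := by rw [Matrix.mul_assoc, ← Matrix.mul_assoc A, hB.mul_mul_left]
  calc B = B * A * B := hB.mul_mul_right.symm
    _ = C * (A * C) := by rw [h2, Matrix.mul_assoc, h1]
    _ = C := by rw [← Matrix.mul_assoc, hC.mul_mul_right]

theorem pinv_eq {ι κ : Type*} [Fintype ι] [Fintype κ] {A : Matrix ι κ ℂ} {B : Matrix κ ι ℂ}
    (h : IsMoorePenrose A B) : pinv A = B :=
  (exists_isMoorePenrose A).choose_spec.unique h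

section Isometry

variable {ι ν : Type*} [Fintype ι] [Fintype ν] [DecidableEq ν]

theorem ofReal_vecNorm_sq (v : ι → ℂ) : ((vecNorm v ^ 2 : ℝ) : ℂ) = star v ⬝ᵥ v := by
  rw [vecNorm_sq, dotProduct]
  push_cast
  exact Finset.sum_congr rfl fun i _ => (Complex.conj_mul' _).symm

theorem vecNorm_mulVec_of_isometry {P : Matrix ι ν ℂ} (hP : Pᴴ * P = 1) (v : ν → ℂ) :
    vecNorm (P *ᵥ v) = vecNorm v := by
  have h : ((vecNorm (P *ᵥ v) ^ 2 : ℝ) : ℂ) = ((vecNorm v ^ 2 : ℝ) : ℂ) := by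
    rw [ofReal_vecNorm_sq, ofReal_vecNorm_sq, Matrix.star_mulVec, Matrix.dotProduct_mulVec,
      Matrix.vecMul_vecMul, hP, Matrix.vecMul_one]
  exact (sq_eq_sq₀ (vecNorm_nonneg _) (vecNorm_nonneg _)).1 (by exact_mod_cast h)

omit [DecidableEq ν] in
-- The squared norm of `Pᴴ v` is the inner product of `P Pᴴ v` with `v`; Cauchy-Schwarz and division
-- by the norm of `Pᴴ v` finish.
theorem vecNorm_conjTranspose_mulVec_le {P : Matrix ι ν ℂ} {c : ℝ} (hc : 0 ≤ c)
    (hP : ∀ v, vecNorm (P *ᵥ v) ≤ c * vecNorm v) (v : ι → ℂ) :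
    vecNorm (Pᴴ *ᵥ v) ≤ c * vecNorm v := by
  have h : ((vecNorm (Pᴴ *ᵥ v) ^ 2 : ℝ) : ℂ) = star (P *ᵥ (Pᴴ *ᵥ v)) ⬝ᵥ v := by
    rw [ofReal_vecNorm_sq, Matrix.star_mulVec P, ← Matrix.dotProduct_mulVec]
  have h2 : vecNorm (Pᴴ *ᵥ v) ^ 2 ≤ c * vecNorm (Pᴴ *ᵥ v) * vecNorm v := by
    calc vecNorm (Pᴴ *ᵥ v) ^ 2 = ‖((vecNorm (Pᴴ *ᵥ v) ^ 2 : ℝ) : ℂ)‖ := by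
          rw [Complex.norm_real, Real.norm_of_nonneg (sq_nonneg _)]
      _ ≤ vecNorm (star (P *ᵥ (Pᴴ *ᵥ v))) * vecNorm v := by
          rw [h]; exact norm_dotProduct_le _ _
      _ ≤ _ := by
          rw [vecNorm_star]
          exact mul_le_mul_of_nonneg_right (hP _) (vecNorm_nonneg _)
  by_contra hlt
  push Not at hlt
  have h3 : 0 < vecNorm (Pᴴ *ᵥ v) := (mul_nonneg hc (vecNorm_nonneg _)).trans_lt hlt
  have h4 := mul_lt_mul_of_pos_left hlt h3
  linarith [h4, h2]

theorem vecNorm_conjTranspose_mulVec_le_of_isometry {P : Matrix ι ν ℂ} (hP : Pᴴ * P = 1)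
    (v : ι → ℂ) : vecNorm (Pᴴ *ᵥ v) ≤ vecNorm v := by
  have := vecNorm_conjTranspose_mulVec_le zero_le_one
    (fun v => (vecNorm_mulVec_of_isometry hP v).trans_le (one_mul _).ge) v
  rwa [one_mul] at this

omit [DecidableEq ν] in
theorem hsNorm_mul_le_of_right {κ : Type*} [Fintype κ] {G : Matrix ι ν ℂ} {c : ℝ} (hc : 0 ≤ c)
    (hG : ∀ v, vecNorm (G *ᵥ v) ≤ c * vecNorm v) (N : Matrix κ ι ℂ) :
    hsNorm (N * G) ≤ c * hsNorm N := by
  have h := hsNorm_mul_le_of_left (vecNorm_conjTranspose_mulVec_le hc hG) hc Nᴴ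
  rwa [← conjTranspose_mul, hsNorm_conjTranspose, hsNorm_conjTranspose] at h

theorem vecNorm_single_one (α : ν) : vecNorm (Pi.single α 1 : ν → ℂ) = 1 := by
  rw [vecNorm_eq_norm]
  exact (PiLp.norm_single 2 (fun _ => ℂ) α (1 : ℂ)).trans norm_one

theorem vecNorm_col_of_isometry {P : Matrix ι ν ℂ} (hP : Pᴴ * P = 1) (α : ν) :
    vecNorm (fun i => P i α) = 1 := by
  have := vecNorm_mulVec_of_isometry hP (Pi.single α 1)
  rw [Matrix.mulVec_single_one] at this
  exact this.trans (vecNorm_single_one α)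

end Isometry

/-! ### Pseudo-inverse of the truncated matrix -/

section Truncation

variable {ι : Type*} [Fintype ι] [DecidableEq ι]

theorem submatrix_isometry {U : Matrix ι ι ℂ} (hU : U ∈ Matrix.unitaryGroup ι ℂ) (p : ι → Prop) :
    (U.submatrix id (Subtype.val : {i // p i} → ι))ᴴ *
      U.submatrix id (Subtype.val : {i // p i} → ι) = 1 := by
  have h := (Matrix.mem_unitaryGroup_iff').1 hU
  ext a b
  have h1 := congrFun (congrFun h a.1) b.1
  rw [Matrix.one_apply] at h1 ⊢
  simp only [Subtype.ext_iff]
  rw [← h1]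
  rfl

variable {M : Matrix ι ι ℂ} (S : SVD M) (η : ℝ)

theorem SVD.truncU_isometry : (S.truncU η)ᴴ * S.truncU η = 1 :=
  submatrix_isometry S.U_mem _

/-- The right singular vectors whose singular values are at least `η`. -/
def SVD.truncW : Matrix ι {i : ι // η ≤ S.sv i} ℂ := S.W.submatrix id Subtype.val

/-- The diagonal matrix of the singular values that are at least `η`. -/
def SVD.truncD : Matrix {i : ι // η ≤ S.sv i} {i : ι // η ≤ S.sv i} ℂ :=
  Matrix.diagonal fun α => (S.sv α : ℂ)

/-- The diagonal matrix of the inverses of the singular values that are at least `η`. -/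
def SVD.truncDInv : Matrix {i : ι // η ≤ S.sv i} {i : ι // η ≤ S.sv i} ℂ :=
  Matrix.diagonal fun α => ((S.sv α)⁻¹ : ℂ)

theorem SVD.truncW_isometry : (S.truncW η)ᴴ * S.truncW η = 1 :=
  submatrix_isometry S.W_mem _

theorem SVD.conjTranspose_truncU_mul :
    (S.truncU η)ᴴ * M = S.truncD η * (S.truncW η)ᴴ := by
  have h : S.Uᴴ * M = Matrix.diagonal (fun i => (S.sv i : ℂ)) * S.Wᴴ := by
    refine (congrArg (S.Uᴴ * ·) S.eq).trans ?_
    rw [Matrix.mul_assoc, ← Matrix.mul_assoc, ← Matrix.star_eq_conjTranspose S.U,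
      (Matrix.mem_unitaryGroup_iff').1 S.U_mem, Matrix.one_mul]
  ext α i
  have h1 := congrFun (congrFun h α.1) i
  rw [Matrix.diagonal_mul] at h1
  rw [SVD.truncD, Matrix.diagonal_mul]
  exact h1

/-- The truncated matrix equals `D Wᴴ` with `D` invertible and `W` an isometry. The lower bound `τ`
is kept apart from the threshold because it is used first as η itself and then, once the spectral
gap is known, as σ - δ. -/
theorem SVD.pinv_eq {τ : ℝ} (hτ : 0 < τ) (h : ∀ i, η ≤ S.sv i → τ ≤ S.sv i) :
    pinv ((S.truncU η)ᴴ * M) = S.truncW η * S.truncDInv η := by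
  refine FCS.pinv_eq ?_
  rw [S.conjTranspose_truncU_mul]
  set P := S.truncW η
  set D := S.truncD η with hD
  set I := S.truncDInv η with hI
  have hP : Pᴴ * P = 1 := S.truncW_isometry η
  have h0 : ∀ α : {i // η ≤ S.sv i}, (S.sv α : ℂ) ≠ 0 := fun α => by
    exact_mod_cast (hτ.trans_le (h _ α.2)).ne'
  have hDI : D * I = 1 := by
    simp only [hD, hI, SVD.truncD, SVD.truncDInv, Matrix.diagonal_mul_diagonal,
      mul_inv_cancel₀ (h0 _), Matrix.diagonal_one]
  have hID : I * D = 1 := by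
    simp only [hD, hI, SVD.truncD, SVD.truncDInv, Matrix.diagonal_mul_diagonal,
      inv_mul_cancel₀ (h0 _), Matrix.diagonal_one]
  have h1 : D * Pᴴ * (P * I) = 1 := by
    rw [Matrix.mul_assoc, ← Matrix.mul_assoc Pᴴ, hP, Matrix.one_mul, hDI]
  have h2 : P * I * (D * Pᴴ) = P * Pᴴ := by
    rw [Matrix.mul_assoc, ← Matrix.mul_assoc I, hID, Matrix.one_mul]
  refine ⟨?_, ?_, ?_, ?_⟩
  · rw [h1, Matrix.one_mul]
  · rw [Matrix.mul_assoc, h1, Matrix.mul_one]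
  · rw [h1]; exact Matrix.isHermitian_one
  · rw [h2]; exact Matrix.isHermitian_mul_conjTranspose_self P

theorem SVD.truncU_mul_pinv {τ : ℝ} (hτ : 0 < τ) (h : ∀ i, η ≤ S.sv i → τ ≤ S.sv i) :
    (S.truncU η)ᴴ * M * pinv ((S.truncU η)ᴴ * M) = 1 := by
  have h0 : ∀ α : {i // η ≤ S.sv i}, (S.sv α : ℂ) ≠ 0 := fun α => by
    exact_mod_cast (hτ.trans_le (h _ α.2)).ne'
  rw [S.pinv_eq η hτ h, S.conjTranspose_truncU_mul, Matrix.mul_assoc, ← Matrix.mul_assoc _ᴴ,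
    S.truncW_isometry, Matrix.one_mul, SVD.truncD, SVD.truncDInv, Matrix.diagonal_mul_diagonal]
  simp only [mul_inv_cancel₀ (h0 _), Matrix.diagonal_one]

theorem SVD.vecNorm_pinv_mulVec_le {τ : ℝ} (hτ : 0 < τ) (h : ∀ i, η ≤ S.sv i → τ ≤ S.sv i)
    (v : {i // η ≤ S.sv i} → ℂ) :
    vecNorm (pinv ((S.truncU η)ᴴ * M) *ᵥ v) ≤ τ⁻¹ * vecNorm v := by
  rw [S.pinv_eq η hτ h, ← Matrix.mulVec_mulVec,
    vecNorm_mulVec_of_isometry (S.truncW_isometry η)]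
  refine le_of_sq_le_sq ?_ (mul_nonneg (inv_nonneg.2 hτ.le) (vecNorm_nonneg _))
  rw [mul_pow, vecNorm_sq, vecNorm_sq, Finset.mul_sum]
  refine Finset.sum_le_sum fun α _ => ?_
  rw [SVD.truncDInv, Matrix.mulVec_diagonal, norm_mul, mul_pow]
  refine mul_le_mul_of_nonneg_right ?_ (sq_nonneg _)
  refine pow_le_pow_left₀ (norm_nonneg _) ?_ 2
  rw [norm_inv, Complex.norm_real, Real.norm_of_nonneg (S.sv_nonneg _)]
  exact inv_anti₀ hτ (h _ α.2)

end Truncation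

/-! ### Stability of the number of large singular values -/

section Weyl

variable {ι : Type*} [Fintype ι] [DecidableEq ι]

omit [DecidableEq ι] in
theorem ofReal_norm_sq_eq_inner (v : EuclideanSpace ℂ ι) :
    ((‖v‖ ^ 2 : ℝ) : ℂ) = inner ℂ v v := by
  rw [inner_self_eq_norm_sq_to_K]
  push_cast
  rfl

/-- The first `m` eigenvectors of the adjoint of `T` composed with `T` have orthogonal images, whose
lengths are the first `m` singular values and so at least the last of these. -/
theorem exists_orthonormal_of_nthSingularValue (M : Matrix ι ι ℂ) {m : ℕ} (hm : 1 ≤ m)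
    (hσ : 0 < nthSingularValue M m) :
    ∃ b : Fin m → EuclideanSpace ℂ ι, Orthonormal ℂ b ∧ ∀ c : Fin m → ℂ,
      nthSingularValue M m * ‖∑ k, c k • b k‖ ≤ ‖Matrix.toEuclideanLin M (∑ k, c k • b k)‖ := by
  set T := Matrix.toEuclideanLin M with hT
  set σ := nthSingularValue M m with hσdef
  have hσ' : σ = T.singularValues (m - 1) := rfl
  have hn : Module.finrank ℂ (EuclideanSpace ℂ ι) = Fintype.card ι := finrank_euclideanSpace
  have hmn : m ≤ Fintype.card ι := by
    by_contra hc
    have := T.singularValues_of_finrank_le (i := m - 1) (by rw [hn]; omega)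
    rw [hσ', this] at hσ
    exact lt_irrefl _ hσ
  set b := T.isSymmetric_adjoint_comp_self.eigenvectorBasis hn with hb
  have hTT : ∀ i j, inner ℂ (T (b i)) (T (b j)) =
      if i = j then ((T.singularValues j : ℝ) : ℂ) ^ 2 else 0 := by
    intro i j
    have h1 : inner ℂ (T (b i)) (T (b j)) = inner ℂ (b i) ((LinearMap.adjoint T ∘ₗ T) (b j)) := by
      rw [LinearMap.comp_apply, LinearMap.adjoint_inner_right]
    rw [h1, hb, LinearMap.IsSymmetric.apply_eigenvectorBasis, ← T.sq_singularValues_fin hn,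
      inner_smul_right, ← hb, orthonormal_iff_ite.1 b.orthonormal]
    split_ifs <;> simp
  let e : Fin m → Fin (Fintype.card ι) := Fin.castLE hmn
  have he : Function.Injective e := Fin.castLE_injective hmn
  refine ⟨fun k => b (e k), b.orthonormal.comp e he, fun c => ?_⟩
  have hb1 : ‖∑ k, c k • b (e k)‖ ^ 2 = ∑ k, ‖c k‖ ^ 2 := by
    have h : ((‖∑ k, c k • b (e k)‖ ^ 2 : ℝ) : ℂ) = ((∑ k, ‖c k‖ ^ 2 : ℝ) : ℂ) := by
      have := (b.orthonormal.comp e he).inner_sum c c Finset.univ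
      simp only [Function.comp_apply] at this
      rw [ofReal_norm_sq_eq_inner, this]
      push_cast
      exact Finset.sum_congr rfl fun k _ => Complex.conj_mul' _
    exact_mod_cast h
  have hb2 : ‖T (∑ k, c k • b (e k))‖ ^ 2 = ∑ k, ‖c k‖ ^ 2 * T.singularValues (e k) ^ 2 := by
    have h : ((‖T (∑ k, c k • b (e k))‖ ^ 2 : ℝ) : ℂ) =
        ((∑ k, ‖c k‖ ^ 2 * T.singularValues (e k) ^ 2 : ℝ) : ℂ) := by
      rw [ofReal_norm_sq_eq_inner]
      push_cast
      simp only [map_sum, map_smul, inner_sum, sum_inner, inner_smul_left, inner_smul_right, hTT,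
        he.eq_iff, mul_ite, mul_zero]
      refine Finset.sum_congr rfl fun k _ => ?_
      rw [← Complex.conj_mul']
      simp
      ring
    exact_mod_cast h
  refine le_of_sq_le_sq ?_ (norm_nonneg _)
  rw [mul_pow, hb1, hb2, Finset.mul_sum]
  refine Finset.sum_le_sum fun k _ => ?_
  rw [mul_comm]
  refine mul_le_mul_of_nonneg_left ?_ (sq_nonneg _)
  refine pow_le_pow_left₀ hσ.le ?_ 2
  rw [hσ']
  exact T.singularValues_antitone (by simp only [e, Fin.val_castLE]; omega)

theorem nthSingularValue_le_hsNorm (M : Matrix ι ι ℂ) {m : ℕ} (hm : 1 ≤ m)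
    (hσ : 0 < nthSingularValue M m) : nthSingularValue M m ≤ hsNorm M := by
  obtain ⟨b, hb, h⟩ := exists_orthonormal_of_nthSingularValue M hm hσ
  have h1 := h (Pi.single ⟨0, hm⟩ 1)
  have h2 : ∑ k, (Pi.single (⟨0, hm⟩ : Fin m) (1 : ℂ) : Fin m → ℂ) k • b k = b ⟨0, hm⟩ := by
    rw [Finset.sum_eq_single ⟨0, hm⟩] <;> simp +contextual
  rw [h2, hb.1, mul_one] at h1
  have h3 := vecNorm_mulVec_le M (b ⟨0, hm⟩).ofLp
  rw [vecNorm_eq_norm, vecNorm_eq_norm, WithLp.toLp_ofLp, hb.1, mul_one] at h3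
  exact h1.trans h3

/-- Dimension count: with too few large singular values of `M'`, some nonzero vector in the span of
the top `m` right singular vectors of `M` is orthogonal to the corresponding right singular vectors
of `M'`. There `M'` contracts below σ - δ, whereas `M` stretches by at least σ. -/
theorem SVD.le_card_of_perturbation {M M' : Matrix ι ι ℂ} (S : SVD M') {m : ℕ} (hm : 1 ≤ m)
    (hσ : 0 < nthSingularValue M m) {δ : ℝ}
    (hδ : ∀ v, vecNorm ((M - M') *ᵥ v) ≤ δ * vecNorm v) (hδσ : δ ≤ nthSingularValue M m) :
    m ≤ Fintype.card {i // nthSingularValue M m - δ ≤ S.sv i} := by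
  set σ := nthSingularValue M m
  obtain ⟨b, hb, h⟩ := exists_orthonormal_of_nthSingularValue M hm hσ
  by_contra hlt
  push Not at hlt
  -- `L` reads off the coordinates along the large right singular vectors of `M'`; its kernel
  -- contains the vector sought.
  let L : (Fin m → ℂ) →ₗ[ℂ] ({i // σ - δ ≤ S.sv i} → ℂ) :=
    { toFun := fun c α => (S.Wᴴ *ᵥ (∑ k, c k • b k).ofLp) α.1
      map_add' := fun c c' => by
        ext α
        simp [add_smul, Finset.sum_add_distrib, Matrix.mulVec_add]
      map_smul' := fun a c => by
        ext α
        simp [mul_smul, ← Finset.smul_sum, Matrix.mulVec_smul] }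
  have hker : LinearMap.ker L ≠ ⊥ := LinearMap.ker_ne_bot_of_finrank_lt (by simpa using hlt)
  obtain ⟨c, hc, hc0⟩ := Submodule.exists_mem_ne_zero_of_ne_bot hker
  set v := ∑ k, c k • b k with hv
  have hv0 : v ≠ 0 := by
    intro h0
    exact hc0 (funext fun k => Fintype.linearIndependent_iff.1 hb.linearIndependent c h0 k)
  set w := S.Wᴴ *ᵥ v.ofLp with hw
  have hw1 : vecNorm w = ‖v‖ := by
    rw [hw, vecNorm_mulVec_of_isometry, vecNorm_eq_norm]
    rw [Matrix.conjTranspose_conjTranspose]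
    exact (Matrix.mem_unitaryGroup_iff).1 S.W_mem
  have hw2 : ∀ i, σ - δ ≤ S.sv i → w i = 0 := fun i hi => congrFun hc ⟨i, hi⟩
  have hM' : vecNorm (M' *ᵥ v.ofLp) ^ 2 = ∑ i, S.sv i ^ 2 * ‖w i‖ ^ 2 := by
    have h0 : M' *ᵥ v.ofLp =
        S.U *ᵥ (Matrix.diagonal (fun i => (S.sv i : ℂ)) *ᵥ (S.Wᴴ *ᵥ v.ofLp)) := by
      rw [Matrix.mulVec_mulVec, Matrix.mulVec_mulVec]
      exact congrArg (· *ᵥ v.ofLp) S.eq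
    rw [h0, ← hw,
      vecNorm_mulVec_of_isometry ((Matrix.mem_unitaryGroup_iff').1 S.U_mem), vecNorm_sq]
    refine Finset.sum_congr rfl fun i _ => ?_
    rw [Matrix.mulVec_diagonal, norm_mul, mul_pow, Complex.norm_real, Real.norm_eq_abs, sq_abs]
  have hlt2 : vecNorm (M' *ᵥ v.ofLp) ^ 2 < ((σ - δ) * ‖v‖) ^ 2 := by
    rw [hM', mul_pow, ← hw1, vecNorm_sq, Finset.mul_sum]
    have hle : ∀ i, w i ≠ 0 → S.sv i ^ 2 * ‖w i‖ ^ 2 < (σ - δ) ^ 2 * ‖w i‖ ^ 2 := by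
      intro i hi
      have h1 : S.sv i < σ - δ := by
        by_contra hc
        exact hi (hw2 i (not_lt.1 hc))
      have h2 := norm_pos_iff.2 hi
      have h3 := S.sv_nonneg i
      have h4 : S.sv i ^ 2 < (σ - δ) ^ 2 := pow_lt_pow_left₀ h1 h3 two_ne_zero
      exact mul_lt_mul_of_pos_right h4 (by positivity)
    have hex : ∃ i, w i ≠ 0 := by
      by_contra hall
      push Not at hall
      have : vecNorm w = 0 := by simp [vecNorm, hall]
      rw [hw1, norm_eq_zero] at this
      exact hv0 this
    obtain ⟨i, hi⟩ := hex
    refine Finset.sum_lt_sum (fun j _ => ?_) ⟨i, Finset.mem_univ i, hle i hi⟩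
    by_cases hj : w j = 0
    · simp [hj]
    · exact (hle j hj).le
  have hge : (σ - δ) * ‖v‖ ≤ vecNorm (M' *ᵥ v.ofLp) := by
    have h1 := h c
    have h2 := hδ v.ofLp
    have h3 : vecNorm (M *ᵥ v.ofLp) ≤ vecNorm ((M - M') *ᵥ v.ofLp) + vecNorm (M' *ᵥ v.ofLp) := by
      refine le_trans (le_of_eq ?_) (vecNorm_add_le _ _)
      rw [Matrix.sub_mulVec, sub_add_cancel]
    have h4 : ‖Matrix.toEuclideanLin M v‖ = vecNorm (M *ᵥ v.ofLp) := by
      rw [vecNorm_eq_norm]; rfl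
    rw [← hv, h4] at h1
    rw [vecNorm_eq_norm v.ofLp, WithLp.toLp_ofLp] at h2
    linarith
  exact absurd (pow_le_pow_left₀ (mul_nonneg (by linarith) (norm_nonneg _)) hge 2) (not_le.2 hlt2)

end Weyl

/-! ### Perturbation of right inverses -/

section RightInverse

variable {ν ι : Type*} [Fintype ν] [DecidableEq ν] [Fintype ι]

/-- A right inverse `G` of `A'` can be corrected to one of a nearby matrix `A`. -/
theorem exists_rightInverse_of_perturbation {A A' : Matrix ν ι ℂ} {G : Matrix ι ν ℂ} {a δ : ℝ}
    (hG : A' * G = 1) (hGa : ∀ v, vecNorm (G *ᵥ v) ≤ a * vecNorm v)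
    (hA : ∀ v, vecNorm ((A' - A) *ᵥ v) ≤ δ * vecNorm v) (ha : 0 ≤ a) (hδ : 0 ≤ δ)
    (haδ : δ * a < 1) :
    ∃ G' : Matrix ι ν ℂ, A * G' = 1 ∧
      (∀ v, vecNorm (G' *ᵥ v) ≤ a / (1 - δ * a) * vecNorm v) ∧
      G' - G = G' * ((A' - A) * G) ∧
      ∀ v, vecNorm (((A' - A) * G) *ᵥ v) ≤ δ * a * vecNorm v := by
  set F := (A' - A) * G with hF
  have hFb : ∀ v, vecNorm (F *ᵥ v) ≤ δ * a * vecNorm v := by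
    intro v
    rw [hF, ← Matrix.mulVec_mulVec, mul_assoc]
    exact (hA _).trans (mul_le_mul_of_nonneg_left (hGa v) hδ)
  have hM : A * G = 1 - F := by
    rw [hF, Matrix.sub_mul, hG, sub_sub_cancel]
  -- Since `A * G` is `1 - F` with `F` a strict contraction, it is bounded below and thus
  -- invertible; `G * (A * G)⁻¹` is the corrected right inverse.
  have hlow : ∀ v, (1 - δ * a) * vecNorm v ≤ vecNorm ((A * G) *ᵥ v) := by
    intro v
    have h1 : vecNorm v ≤ vecNorm ((1 - F) *ᵥ v) + vecNorm (F *ᵥ v) := by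
      refine le_trans (le_of_eq ?_) (vecNorm_add_le _ _)
      rw [Matrix.sub_mulVec, Matrix.one_mulVec, sub_add_cancel]
    have h2 := hFb v
    rw [hM]
    linarith
  have hunit : IsUnit (A * G) := by
    rw [← Matrix.mulVec_injective_iff_isUnit]
    intro u v huv
    have h1 := hlow (u - v)
    rw [Matrix.mulVec_sub, sub_eq_zero.2 huv] at h1
    have h2 : vecNorm (0 : ν → ℂ) = 0 := by simp [vecNorm]
    rw [h2] at h1
    have h3 : vecNorm (u - v) = 0 := by
      have := vecNorm_nonneg (u - v)
      by_contra hne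
      have h4 : 0 < vecNorm (u - v) := lt_of_le_of_ne this (Ne.symm hne)
      have h5 : 0 < 1 - δ * a := by linarith
      linarith [mul_pos h5 h4]
    rw [vecNorm_eq_norm, norm_eq_zero] at h3
    exact sub_eq_zero.1 (congrArg WithLp.ofLp h3)
  have hdet : IsUnit (A * G).det := (Matrix.isUnit_iff_isUnit_det _).1 hunit
  refine ⟨G * (A * G)⁻¹, ?_, fun v => ?_, ?_, hFb⟩
  · rw [← Matrix.mul_assoc, Matrix.mul_nonsing_inv _ hdet]
  · rw [← Matrix.mulVec_mulVec]
    refine (hGa _).trans ?_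
    have h1 := hlow ((A * G)⁻¹ *ᵥ v)
    rw [Matrix.mulVec_mulVec, Matrix.mul_nonsing_inv _ hdet, Matrix.one_mulVec] at h1
    rw [div_mul_eq_mul_div, mul_div_assoc]
    refine mul_le_mul_of_nonneg_left ?_ ha
    rw [le_div_iff₀ (by linarith), mul_comm]
    exact h1
  · have h1 : F = 1 - A * G := by rw [hM, sub_sub_cancel]
    rw [h1, Matrix.mul_sub, Matrix.mul_one, Matrix.mul_assoc, Matrix.nonsing_inv_mul _ hdet,
      Matrix.mul_one]

theorem card_le_of_mul_eq_one {m : ℕ} {F : Matrix ν (Fin m) ℂ} {G : Matrix (Fin m) ν ℂ}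
    (h : F * G = 1) : Fintype.card ν ≤ m := by
  have h1 := Matrix.rank_mul_le_left F G
  rw [h, Matrix.rank_one] at h1
  exact h1.trans ((Matrix.rank_le_card_width F).trans (by simp))

end RightInverse

/-! ### Orthonormal families of self-adjoint operators -/

section Bessel

variable {τ κ : Type*} [Fintype τ] [Fintype κ] [DecidableEq κ]
  {S : Submodule ℂ (Matrix τ τ ℂ)} {b : κ → Matrix τ τ ℂ}

theorem inner_toLp_eq_trace {A : Matrix τ τ ℂ} (hA : A.IsHermitian) (D : Matrix τ τ ℂ) :
    inner ℂ (WithLp.toLp 2 fun p : τ × τ => A p.1 p.2)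
      (WithLp.toLp 2 fun p : τ × τ => D p.1 p.2) = (D * A).trace := by
  rw [PiLp.inner_apply, Fintype.sum_prod_type, Matrix.trace]
  refine Finset.sum_congr rfl fun i _ => ?_
  rw [Matrix.diag_apply, Matrix.mul_apply]
  refine Finset.sum_congr rfl fun j _ => ?_
  rw [RCLike.inner_apply, ← hA.apply j i]
  simp

omit [Fintype κ] in
theorem IsHSBasis.orthonormal_toLp (hb : IsHSBasis S b) :
    Orthonormal ℂ fun k => (WithLp.toLp 2 fun p : τ × τ => b k p.1 p.2) := by
  rw [orthonormal_iff_ite]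
  intro i j
  rw [inner_toLp_eq_trace (hb.isHermitian i), hb.orthonormal]
  simp only [eq_comm]

/-- Bessel's inequality; self-adjointness of the basis makes these traces the Hilbert-Schmidt inner
products. -/
theorem IsHSBasis.sum_norm_trace_sq_le (hb : IsHSBasis S b) (D : Matrix τ τ ℂ) :
    ∑ k, ‖(D * b k).trace‖ ^ 2 ≤ hsNorm D ^ 2 := by
  have h := hb.orthonormal_toLp.sum_inner_products_le (WithLp.toLp 2 fun p : τ × τ => D p.1 p.2)
    (s := Finset.univ)
  simp only [inner_toLp_eq_trace (hb.isHermitian _)] at h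
  rwa [hsNorm_eq_vecNorm, vecNorm_eq_norm]

theorem IsHSBasis.hsNorm_sum_smul (hb : IsHSBasis S b) (c : κ → ℂ) :
    hsNorm (∑ k, c k • b k) = vecNorm c := by
  have h : ((hsNorm (∑ k, c k • b k) ^ 2 : ℝ) : ℂ) = ((vecNorm c ^ 2 : ℝ) : ℂ) := by
    have h1 := hb.orthonormal_toLp.inner_sum c c Finset.univ
    have h2 : (WithLp.toLp 2 fun p : τ × τ => (∑ k, c k • b k) p.1 p.2) =
        ∑ k, c k • WithLp.toLp 2 fun p : τ × τ => b k p.1 p.2 := by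
      ext p
      simp [Matrix.sum_apply]
    rw [hsNorm_eq_vecNorm, vecNorm_eq_norm, ofReal_norm_sq_eq_inner, h2, h1, ofReal_vecNorm_sq]
    rfl
  exact (sq_eq_sq₀ (hsNorm_nonneg _) (vecNorm_nonneg _)).1 (by exact_mod_cast h)

end Bessel

/-! ### Coefficient matrices of functionals on adjacent blocks -/

section Families

variable {d : ℕ} {𝒜 : StarSubalgebra ℂ (Matrix (Fin d) (Fin d) ℂ)} {s : ℕ}
  {ι κ : Type*} [Fintype ι] [DecidableEq ι] [Fintype κ] [DecidableEq κ]

theorem isHermitian_tens {k l : ℕ} {A : Op d k} {B : Op d l} (hA : A.IsHermitian)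
    (hB : B.IsHermitian) : (tens A B).IsHermitian := by
  ext x y
  rw [Matrix.conjTranspose_apply, tens, Matrix.of_apply, Matrix.of_apply, star_mul', hA.apply,
    hB.apply]

omit [Fintype ι] [Fintype κ] in
theorem IsHSBasis.tens {k l : ℕ} {S : Submodule ℂ (Op d k)} {T : Submodule ℂ (Op d l)}
    {a : ι → Op d k} {b : κ → Op d l} (ha : IsHSBasis S a) (hb : IsHSBasis T b) :
    IsHSBasis (Submodule.span ℂ (Set.range fun p : ι × κ => FCS.tens (a p.1) (b p.2)))
      (fun p : ι × κ => FCS.tens (a p.1) (b p.2)) := by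
  refine ⟨fun p => isHermitian_tens (ha.isHermitian _) (hb.isHermitian _), fun p q => ?_, rfl⟩
  rw [trace_tens_mul_tens, ha.orthonormal, hb.orthonormal]
  simp only [Prod.ext_iff, ite_and]
  split_ifs <;> simp

theorem IsHSBasis.oneSite {Z : κ → Matrix (Fin d) (Fin d) ℂ}
    (hZ : IsHSBasis (Subalgebra.toSubmodule 𝒜.toSubalgebra) Z) :
    IsHSBasis (blockAlg 𝒜 1) (fun k => FCS.oneSite (Z k)) := by
  have h := hZ.block 1
  refine ⟨fun k => h.isHermitian fun _ => k, fun k l => ?_, ?_⟩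
  · have := h.orthonormal (fun _ => k) (fun _ => l)
    rw [FCS.oneSite, FCS.oneSite, this]
    simp [funext_iff]
  · rw [← h.span_eq]
    congr 1
    ext A
    constructor
    · rintro ⟨k, rfl⟩
      exact ⟨fun _ => k, rfl⟩
    · rintro ⟨w, rfl⟩
      refine ⟨w 0, ?_⟩
      simp only [FCS.oneSite]
      congr 1
      funext i
      rw [Subsingleton.elim i 0]

variable {Y X : ι → Op d s} {Z : κ → Matrix (Fin d) (Fin d) ℂ}

theorem hsNorm_omegaMatrix_le (hY : IsHSBasis (blockAlg 𝒜 s) Y)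
    (hX : IsHSBasis (blockAlg 𝒜 s) X) (D : Op d (s + s)) :
    hsNorm (omegaMatrix D Y X) ≤ hsNorm D := by
  refine le_of_sq_le_sq ?_ (hsNorm_nonneg _)
  have := (hY.tens hX).sum_norm_trace_sq_le D
  rw [Fintype.sum_prod_type] at this
  rwa [hsNorm_sq]

/-- All entries for all `k` together are coefficients of `D` in one orthonormal product family.
Summing over `k` before taking roots avoids a factor for the dimension of the one-site algebra. -/
theorem sum_hsNorm_omegaMatrixAt_sq_le (hY : IsHSBasis (blockAlg 𝒜 s) Y)
    (hX : IsHSBasis (blockAlg 𝒜 s) X)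
    (hZ : IsHSBasis (Subalgebra.toSubmodule 𝒜.toSubalgebra) Z) (D : Op d (s + 1 + s)) :
    ∑ k, hsNorm (omegaMatrixAt D Y X (Z k)) ^ 2 ≤ hsNorm D ^ 2 := by
  have := ((hY.tens hZ.oneSite).tens hX).sum_norm_trace_sq_le D
  rw [Fintype.sum_prod_type, Fintype.sum_prod_type, Finset.sum_comm] at this
  simp only [hsNorm_sq] at this ⊢
  exact this

omit [Fintype ι] [DecidableEq ι] in
theorem omegaMatrix_sub (D D' : Op d (s + s)) :
    omegaMatrix (D - D') Y X = omegaMatrix D Y X - omegaMatrix D' Y X := by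
  ext
  simp [omegaMatrix, Matrix.sub_mul]

omit [Fintype ι] [DecidableEq ι] in
theorem omegaMatrixAt_sub (D D' : Op d (s + 1 + s)) (A : Matrix (Fin d) (Fin d) ℂ) :
    omegaMatrixAt (D - D') Y X A = omegaMatrixAt D Y X A - omegaMatrixAt D' Y X A := by
  ext
  simp [omegaMatrixAt, Matrix.sub_mul]

omit [DecidableEq ι] in
theorem trace_mul_tens_sum {ν : Type*} (D : Op d (s + s)) (U G : Matrix ι ν ℂ) (α β : ν) :
    (D * tens (∑ j, star (U j α) • Y j) (∑ i, G i β • X i)).trace =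
      (Uᴴ * omegaMatrix D Y X * G) α β := by
  simp only [Matrix.mul_apply, tens_sum_left, tens_sum_right, tens_smul_left, tens_smul_right,
    Finset.mul_sum, Finset.sum_mul, Matrix.trace_sum, Matrix.mul_smul,
    Matrix.trace_smul, omegaMatrix, Matrix.of_apply, Matrix.conjTranspose_apply, smul_eq_mul]
  refine Finset.sum_congr rfl fun i _ => Finset.sum_congr rfl fun j _ => ?_
  ring

omit [DecidableEq ι] in
theorem trace_mul_tens_tens_sum {ν : Type*} (D : Op d (s + 1 + s)) (U G : Matrix ι ν ℂ)
    (A : Matrix (Fin d) (Fin d) ℂ) (α β : ν) :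
    (D * tens (tens (∑ j, star (U j α) • Y j) (oneSite A)) (∑ i, G i β • X i)).trace =
      (Uᴴ * omegaMatrixAt D Y X A * G) α β := by
  simp only [Matrix.mul_apply, tens_sum_left, tens_sum_right, tens_smul_left, tens_smul_right,
    Finset.mul_sum, Finset.sum_mul, Matrix.trace_sum, Matrix.mul_smul,
    Matrix.trace_smul, omegaMatrixAt, Matrix.of_apply, Matrix.conjTranspose_apply, smul_eq_mul]
  refine Finset.sum_congr rfl fun i _ => Finset.sum_congr rfl fun j _ => ?_
  ring

end Families

/-! ### The rank of the map `Ω` -/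

section Rank

variable {d : ℕ} {𝒜 : StarSubalgebra ℂ (Matrix (Fin d) (Fin d) ℂ)} (ω : TIState 𝒜)

/-- Padding both blocks with identities away from the cut leaves expectations unchanged, so the map
for small blocks factors through the one for large blocks. -/
theorem finrank_range_omegaMap_le_add (k l r r' : ℕ) :
    Module.finrank ℂ (LinearMap.range (omegaMap ω k l)) ≤
      Module.finrank ℂ (LinearMap.range (omegaMap ω (r + k) (l + r'))) := by
  let R : blockAlg 𝒜 l →ₗ[ℂ] blockAlg 𝒜 (l + r') :=
    { toFun := fun X => ⟨tens (X : Op d l) (1 : Op d r'), tens_mem X.2 one_mem_blockAlg⟩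
      map_add' := fun X X' => Subtype.ext (tens_add_left _ _ _)
      map_smul' := fun c X => Subtype.ext (tens_smul_left _ _ _) }
  let L : blockAlg 𝒜 k →ₗ[ℂ] blockAlg 𝒜 (r + k) :=
    { toFun := fun X => ⟨tens (1 : Op d r) (X : Op d k), tens_mem one_mem_blockAlg X.2⟩
      map_add' := fun X X' => Subtype.ext (tens_add_right _ _ _)
      map_smul' := fun c X => Subtype.ext (tens_smul_right _ _ _) }
  have h : omegaMap ω k l = L.dualMap ∘ₗ omegaMap ω (r + k) (l + r') ∘ₗ R := by
    ext X Y
    show ω.ev (k + l) (tens (Y : Op d k) (X : Op d l)) =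
      ω.ev (r + k + (l + r')) (tens (tens 1 (Y : Op d k)) (tens (X : Op d l) 1))
    rw [← ω.ev_assoc_inner]
    have h1 := ω.right_compat (r + (k + l)) r' (tens 1 (tens (Y : Op d k) (X : Op d l)))
      (tens_mem one_mem_blockAlg (tens_mem Y.2 X.2))
    have h2 := ω.left_compat r (k + l) (tens (Y : Op d k) (X : Op d l)) (tens_mem Y.2 X.2)
    exact (h1.trans h2).symm
  have hrange : LinearMap.range (omegaMap ω k l) ≤
      (LinearMap.range (omegaMap ω (r + k) (l + r'))).map L.dualMap := by
    rw [h, LinearMap.range_comp]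
    exact Submodule.map_mono (LinearMap.range_comp_le_range _ _)
  exact (Submodule.finrank_mono hrange).trans (Submodule.finrank_map_le _ _)

theorem finrank_range_omegaMap_mono {k l k' l' : ℕ} (hk : k ≤ k') (hl : l ≤ l') :
    Module.finrank ℂ (LinearMap.range (omegaMap ω k l)) ≤
      Module.finrank ℂ (LinearMap.range (omegaMap ω k' l')) := by
  obtain ⟨r, rfl⟩ := Nat.exists_eq_add_of_le' hk
  obtain ⟨r', rfl⟩ := Nat.exists_eq_add_of_le hl
  exact finrank_range_omegaMap_le_add ω k l r r'

variable {s : ℕ} {ι : Type*} [Fintype ι] [DecidableEq ι] {Y X : ι → Op d s}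

/-- Coordinates in the two bases factor the map through its matrix. The inequality suffices to make
the `m`-th singular value positive. -/
theorem finrank_range_omegaMap_le_omegaMatrix (hY : IsHSBasis (blockAlg 𝒜 s) Y)
    (hX : IsHSBasis (blockAlg 𝒜 s) X) :
    Module.finrank ℂ (LinearMap.range (omegaMap ω s s)) ≤ Module.finrank ℂ
      (LinearMap.range (Matrix.toEuclideanLin (omegaMatrix (ω.dens (s + s)) Y X))) := by
  set T := Matrix.toEuclideanLin (omegaMatrix (ω.dens (s + s)) Y X)
  let R : blockAlg 𝒜 s →ₗ[ℂ] EuclideanSpace ℂ ι :=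
    { toFun := fun A => WithLp.toLp 2 fun i => ((A : Op d s) * X i).trace
      map_add' := fun A B => by ext i; simp [Matrix.add_mul]
      map_smul' := fun c A => by ext i; simp }
  let L : EuclideanSpace ℂ ι →ₗ[ℂ] Module.Dual ℂ (blockAlg 𝒜 s) :=
    LinearMap.mk₂ ℂ (fun v (B : blockAlg 𝒜 s) => ∑ j, v j * ((B : Op d s) * Y j).trace)
      (fun v w B => by simp [add_mul, Finset.sum_add_distrib])
      (fun c v B => by simp [Finset.mul_sum, mul_assoc])
      (fun v B B' => by simp [Matrix.add_mul, mul_add, Finset.sum_add_distrib])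
      (fun c v B => by simp [Finset.mul_sum, mul_left_comm])
  have h : omegaMap ω s s = L ∘ₗ T ∘ₗ R := by
    ext A B
    show ω.ev (s + s) (tens (B : Op d s) (A : Op d s)) =
      ∑ j, (∑ i, ω.ev (s + s) (tens (Y j) (X i)) * ((A : Op d s) * X i).trace) *
        ((B : Op d s) * Y j).trace
    conv_lhs => rw [hX.expand A.2, hY.expand B.2]
    simp only [tens_sum_left, tens_sum_right, tens_smul_left, tens_smul_right, map_sum, map_smul,
      smul_eq_mul, Finset.mul_sum, Finset.sum_mul]
    rw [Finset.sum_comm]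
    refine Finset.sum_congr rfl fun j _ => Finset.sum_congr rfl fun i _ => ?_
    ring
  have hrange : LinearMap.range (omegaMap ω s s) ≤ (LinearMap.range T).map L := by
    rw [h, LinearMap.range_comp]
    exact Submodule.map_mono (LinearMap.range_comp_le_range _ _)
  exact (Submodule.finrank_mono hrange).trans (Submodule.finrank_map_le _ _)

variable {ω}

theorem IsFinitelyCorrelatedOfDim.one_le {m : ℕ} (hm : IsFinitelyCorrelatedOfDim ω m) : 1 ≤ m := by
  obtain ⟨R⟩ := hm.1
  by_contra hlt
  obtain rfl : m = 0 := by omega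
  have h := R.expect 0 Fin.elim0
  have h0 : ∀ v : Fin 0 → ℂ, R.rho v = 0 := fun v => by rw [Subsingleton.elim v 0, map_zero]
  rw [tensorProd_eq_one, Matrix.mul_one, ω.trace_one, h0] at h
  exact one_ne_zero h

theorem TIState.one_le_dim (ω : TIState 𝒜) : 1 ≤ d := by
  by_contra hlt
  obtain rfl : d = 0 := by omega
  have h := ω.trace_one 1
  simp [Matrix.trace] at h

theorem nthSingularValue_omegaMatrix_pos {m t₁ t₂ : ℕ} (hm : 1 ≤ m)
    (hΩ : Module.finrank ℂ (LinearMap.range (omegaMap ω t₁ t₂)) = m) (hs : max t₁ t₂ ≤ s)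
    (hY : IsHSBasis (blockAlg 𝒜 s) Y) (hX : IsHSBasis (blockAlg 𝒜 s) X) :
    0 < nthSingularValue (omegaMatrix (ω.dens (s + s)) Y X) m := by
  rw [nthSingularValue, LinearMap.singularValues_pos_iff_lt_finrank_range]
  have h1 := finrank_range_omegaMap_mono ω (le_of_max_le_left hs) (le_of_max_le_right hs)
  have h2 := finrank_range_omegaMap_le_omegaMatrix ω hY hX
  omega

end Rank

/-! ### From dual families to a resolution of correlations -/

section Frame

variable {d : ℕ} {𝒜 : StarSubalgebra ℂ (Matrix (Fin d) (Fin d) ℂ)} {ω : TIState 𝒜} {s m : ℕ}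
  {κ ν : Type*} [Fintype κ] [DecidableEq κ] [Fintype ν] [DecidableEq ν]
  {Z : κ → Matrix (Fin d) (Fin d) ℂ} {y x : ν → Op d s}

/-- The identity matrix of pairings factors through `m` dimensions, so its rank is at most `m`. -/
theorem Realization.card_le_of_dual (R : Realization ω (Fin m → ℂ))
    (hZ : IsHSBasis (Subalgebra.toSubmodule 𝒜.toSubalgebra) Z)
    (hy : ∀ β, y β ∈ blockAlg 𝒜 s) (hx : ∀ β, x β ∈ blockAlg 𝒜 s)
    (hdual : ∀ α β, ω.ev (s + s) (tens (y α) (x β)) = if α = β then 1 else 0) :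
    Fintype.card ν ≤ m := by
  obtain ⟨f, g, hfg⟩ := R.exists_factorization hZ
  refine card_le_of_mul_eq_one (F := Matrix.of fun α => f s (y α))
    (G := (Matrix.of fun β => g s (x β))ᵀ) ?_
  ext α β
  rw [Matrix.one_apply, ← hdual, hfg _ _ _ (hy α) _ (hx β)]
  rfl

/-- With exactly `m` members the factors of the pairing matrix are square, so a one-sided inverse is
two-sided; inserting `Gᵀ * F = 1` at the cut gives the resolution. -/
theorem Realization.dualFrame (R : Realization ω (Fin m → ℂ))
    (hZ : IsHSBasis (Subalgebra.toSubmodule 𝒜.toSubalgebra) Z) {a : ℝ}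
    (hy : ∀ β, y β ∈ blockAlg 𝒜 s) (hx : ∀ β, x β ∈ blockAlg 𝒜 s)
    (hy1 : ∀ β, hsNorm (y β) ≤ 1) (hxa : ∀ β, hsNorm (x β) ≤ a)
    (hdual : ∀ α β, ω.ev (s + s) (tens (y α) (x β)) = if α = β then 1 else 0)
    (hcard : Fintype.card ν = m) : DualFrame ω y x a := by
  refine ⟨hy, hx, hy1, hxa, hdual, fun k l A hA B hB => ?_⟩
  obtain ⟨f, g, hfg⟩ := R.exists_factorization hZ
  let F : Matrix ν (Fin m) ℂ := Matrix.of fun α => f s (y α)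
  let G : Matrix ν (Fin m) ℂ := Matrix.of fun β => g s (x β)
  have h1 : F * Gᵀ = 1 := by
    ext α β
    rw [Matrix.one_apply, ← hdual, hfg _ _ _ (hy α) _ (hx β)]
    rfl
  have h2 : Gᵀ * F = 1 :=
    (Matrix.mul_eq_one_comm_of_card_eq _ _ _ (by simpa using hcard)).1 h1
  have h3 : f k A ⬝ᵥ g l B = (f k A ᵥ* Gᵀ) ⬝ᵥ (F *ᵥ g l B) := by
    rw [← Matrix.dotProduct_mulVec, Matrix.mulVec_mulVec, h2, Matrix.one_mulVec]
  rw [hfg _ _ _ hA _ hB, h3, dotProduct]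
  refine Finset.sum_congr rfl fun β _ => ?_
  rw [hfg _ _ _ hA _ (hx β), hfg _ _ _ (hy β) _ hB]
  rfl

end Frame

/-! ### The output as an iterated row vector -/

section Output

variable {d : ℕ} {κ ν : Type*} [Fintype κ] [Fintype ν] [DecidableEq ν]

theorem mpoRow_eq_sum (r : ν → ℂ) (K : κ → Matrix ν ν ℂ) (Z : κ → Matrix (Fin d) (Fin d) ℂ)
    (n : ℕ) (γ : ν) :
    mpoRow r (fun β γ => ∑ k, K k β γ • oneSite (Z k)) n γ =
      ∑ w : Fin n → κ, (r ᵥ* (List.ofFn fun i => K (w i)).prod) γ •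
        tensorProd fun i => Z (w i) := by
  induction n generalizing γ with
  | zero => simp [mpoRow, tensorProd_eq_one]
  | succ n ih =>
    have hterm : ∀ (a : Fin n → κ) (b : Fin 1 → κ),
        (r ᵥ* (List.ofFn fun i => K (Fin.append a b i)).prod) γ •
          tensorProd (fun i => Z (Fin.append a b i)) =
        ∑ β, (r ᵥ* (List.ofFn fun i => K (a i)).prod) β • K (b 0) β γ •
          tens (tensorProd fun i => Z (a i)) (oneSite (Z (b 0))) := by
      intro a b
      have hK : (fun i => K (Fin.append a b i)) =
          Fin.append (fun i => K (a i)) (fun i => K (b i)) := by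
        funext i
        refine Fin.addCases (fun i => ?_) (fun i => ?_) i <;> simp
      have hZ : (fun i => Z (Fin.append a b i)) =
          Fin.append (fun i => Z (a i)) (fun i => Z (b i)) := by
        funext i
        refine Fin.addCases (fun i => ?_) (fun i => ?_) i <;> simp
      have hb : (fun i => Z (b i)) = fun _ => Z (b 0) := by
        funext i; rw [Subsingleton.elim i 0]
      rw [hK, hZ, tensorProd_append, List.ofFn_fin_append, List.prod_append, hb]
      simp only [smul_smul, ← Finset.sum_smul]
      congr 1
      rw [← Matrix.vecMul_vecMul]
      simp [Matrix.vecMul, dotProduct]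
    rw [sum_append, mpoRow_succ]
    simp only [hterm, ih]
    simp only [tens_sum_left, tens_sum_right, tens_smul_left, tens_smul_right]
    simp only [Finset.smul_sum]
    have hone : ∀ a : Fin n → κ, ∑ b : Fin 1 → κ, ∑ β,
        (r ᵥ* (List.ofFn fun i => K (a i)).prod) β • K (b 0) β γ •
          tens (tensorProd fun i => Z (a i)) (oneSite (Z (b 0))) =
        ∑ k, ∑ β, (r ᵥ* (List.ofFn fun i => K (a i)).prod) β • K k β γ •
          tens (tensorProd fun i => Z (a i)) (oneSite (Z k)) := fun a =>
      Fintype.sum_equiv (Equiv.funUnique (Fin 1) κ) _ _ fun _ => rfl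
    rw [Finset.sum_congr rfl fun a _ => hone a, Finset.sum_comm,
      Finset.sum_congr rfl fun k _ => Finset.sum_comm, Finset.sum_comm]
    exact Finset.sum_congr rfl fun β _ => Finset.sum_congr rfl fun k _ =>
      Finset.sum_congr rfl fun a _ => smul_comm _ _ _

theorem sum_smul_mpoRow (r e : ν → ℂ) (K : κ → Matrix ν ν ℂ)
    (Z : κ → Matrix (Fin d) (Fin d) ℂ) (n : ℕ) :
    ∑ β, e β • mpoRow r (fun β γ => ∑ k, K k β γ • oneSite (Z k)) n β =
      ∑ w : Fin n → κ, (r ⬝ᵥ ((List.ofFn fun i => K (w i)).prod *ᵥ e)) •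
        tensorProd fun i => Z (w i) := by
  simp only [mpoRow_eq_sum, Finset.smul_sum]
  rw [Finset.sum_comm]
  refine Finset.sum_congr rfl fun w _ => ?_
  rw [Matrix.dotProduct_mulVec, dotProduct, Finset.sum_smul]
  exact Finset.sum_congr rfl fun β _ => by rw [smul_smul, mul_comm]

end Output

/-! ### Accuracy of the algorithm -/

/-! ### Evaluation of the constants -/

section Numerics

/-- All powers of 1/σ sit in `g`, and at most three occur, so the factor σ³ in δ absorbs them. The
right side is 2ε because the trace distance carries a factor 1/2. -/
theorem total_error_le {d m t : ℕ} (hd : 1 ≤ d) (hm : 1 ≤ m) (ht : 1 ≤ t) {ε σ δ : ℝ}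
    (hε : 0 < ε) (hε' : ε < 1) (hσ : 0 < σ) (hσ1 : σ ≤ 1)
    (hδ : δ = ε * σ ^ 3 / (20 * t * m * √d)) {g : ℝ} (hg : g = 3 / (2 * σ)) :
    (1 + g * √d * (m * (3 / 2 * g * δ * (1 + g)))) ^ t * (1 + m * (δ * g * (1 + g))) *
      (1 + g * (m * δ)) - 1 ≤ 2 * ε := by
  have hd' : 1 ≤ √(d : ℝ) := Real.one_le_sqrt.2 (by exact_mod_cast hd)
  have hm' : (1 : ℝ) ≤ m := by exact_mod_cast hm
  have ht' : (1 : ℝ) ≤ t := by exact_mod_cast ht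
  have hg0 : 0 < g := by rw [hg]; positivity
  have hδ0 : 0 < δ := by rw [hδ]; positivity
  have hq : m * δ * (t * √d) = ε * σ ^ 3 / 20 := by rw [hδ]; field_simp
  have hgσ : g * σ = 3 / 2 := by rw [hg]; field_simp
  set θ := g * √d * (m * (3 / 2 * g * δ * (1 + g))) with hθ
  set r := m * (δ * g * (1 + g)) with hr
  set e := g * (m * δ) with he
  have hθ0 : 0 ≤ θ := by positivity
  have hr0 : 0 ≤ r := by positivity
  have he0 : 0 ≤ e := by positivity
  have hmδ : m * δ ≤ ε * σ ^ 3 / 20 := by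
    rw [← hq]
    exact le_mul_of_one_le_right (by positivity) (one_le_mul_of_one_le_of_one_le ht' hd')
  -- With g σ = 3/2 and σ ≤ 1 the coefficient is at most (27/8)(5/2) = 8.4375.
  have h1 : t * θ ≤ ε * (8.5 / 20) := by
    have : t * θ = 3 / 2 * (g * g * (1 + g)) * (m * δ * (t * √d)) := by rw [hθ]; ring
    rw [this, hq]
    have : 3 / 2 * (g * g * (1 + g)) * (ε * σ ^ 3 / 20) =
        ε * (3 / 2 * ((g * σ) * (g * σ) * (σ + g * σ)) / 20) := by ring
    rw [this, hgσ]
    refine mul_le_mul_of_nonneg_left ?_ hε.le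
    linarith
  have h2 : r ≤ ε * (3.75 / 20) := by
    have h3 : r ≤ g * (1 + g) * (ε * σ ^ 3 / 20) := by
      have : r = g * (1 + g) * (m * δ) := by rw [hr]; ring
      rw [this]
      exact mul_le_mul_of_nonneg_left hmδ (by positivity)
    have : g * (1 + g) * (ε * σ ^ 3 / 20) = ε * ((g * σ) * (σ + g * σ) * σ / 20) := by ring
    rw [this, hgσ] at h3
    refine h3.trans (mul_le_mul_of_nonneg_left ?_ hε.le)
    nlinarith
  have h3 : e ≤ ε * (1.5 / 20) := by
    have h4 : e ≤ g * (ε * σ ^ 3 / 20) := mul_le_mul_of_nonneg_left hmδ hg0.le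
    have : g * (ε * σ ^ 3 / 20) = ε * ((g * σ) * σ ^ 2 / 20) := by ring
    rw [this, hgσ] at h4
    refine h4.trans (mul_le_mul_of_nonneg_left ?_ hε.le)
    nlinarith
  have hexp : (1 + θ) ^ t * (1 + r) * (1 + e) ≤ Real.exp (t * θ + r + e) := by
    rw [Real.exp_add, Real.exp_add, Real.exp_nat_mul]
    have a1 : 1 + θ ≤ Real.exp θ := by rw [add_comm]; exact Real.add_one_le_exp θ
    have a2 : 1 + r ≤ Real.exp r := by rw [add_comm]; exact Real.add_one_le_exp r
    have a3 : 1 + e ≤ Real.exp e := by rw [add_comm]; exact Real.add_one_le_exp e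
    gcongr
  -- The three contributions add up to 13.75/20 of ε; then exp ε - 1 ≤ 2ε since ε < 1.
  have hS : t * θ + r + e ≤ ε := by linarith
  have h4 : Real.exp (t * θ + r + e) ≤ Real.exp ε := Real.exp_le_exp.2 hS
  have h5 := (abs_le.1 (Real.abs_exp_sub_one_le (x := ε) (by rw [abs_of_pos hε]; exact hε'.le))).2
  rw [abs_of_pos hε] at h5
  linarith

end Numerics

/-! ### Comparison of the output with the true state in the adapted gauge -/

section Accuracy

variable {d : ℕ} {𝒜 : StarSubalgebra ℂ (Matrix (Fin d) (Fin d) ℂ)} {ω : TIState 𝒜} {s : ℕ}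
  {ι κ : Type*} [Fintype ι] [DecidableEq ι] [Fintype κ] [DecidableEq κ]
  {Y X : ι → Op d s} {Z : κ → Matrix (Fin d) (Fin d) ℂ}

omit [DecidableEq κ] in
theorem learnFCS_eq_sum_smul_mpoRow (η : ℝ) (est : Estimates d s)
    (S : SVD (omegaMatrix est.two Y X)) (t : ℕ) :
    learnFCS Y X Z η est S t = ∑ β, hatE Y X η est S β • mpoRow (hatRho Y X η est S)
      (fun β γ => ∑ k, hatK Y X η est S (Z k) β γ • oneSite (Z k)) t β :=
  (sum_smul_mpoRow _ _ (fun k => hatK Y X η est S (Z k)) Z t).symm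

omit [DecidableEq κ] in
/-- A sum of `ℓ²` norms is bounded by the `ℓ²` norm of the whole array. -/
theorem sum_sum_vecNorm_le {ν : Type*} [Fintype ν] {Δ : κ → Matrix ν ν ℂ} {c : ℝ} (hc : 0 ≤ c)
    (h : ∑ k, hsNorm (Δ k) ^ 2 ≤ c ^ 2) :
    ∑ β, ∑ γ, vecNorm (fun k => Δ k β γ) ≤ Fintype.card ν * c := by
  refine le_of_sq_le_sq ?_ (by positivity)
  have h1 := sq_sum_le_card_mul_sum_sq (s := (Finset.univ : Finset (ν × ν)))
    (f := fun p => vecNorm fun k => Δ k p.1 p.2)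
  rw [Fintype.sum_prod_type, Fintype.sum_prod_type] at h1
  refine h1.trans ?_
  have h2 : ∑ β, ∑ γ, vecNorm (fun k => Δ k β γ) ^ 2 = ∑ k, hsNorm (Δ k) ^ 2 := by
    simp only [vecNorm_sq, hsNorm_sq]
    rw [Finset.sum_congr rfl fun β _ => Finset.sum_comm, Finset.sum_comm]
  rw [h2, mul_pow, Finset.card_univ, Fintype.card_prod]
  push_cast
  rw [← sq]
  exact mul_le_mul_of_nonneg_left h (sq_nonneg _)

theorem nuc_learnFCS_sub_dens {m : ℕ} (R : Realization ω (Fin m → ℂ))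
    (hm : 1 ≤ m) (hY : IsHSBasis (blockAlg 𝒜 s) Y) (hX : IsHSBasis (blockAlg 𝒜 s) X)
    (hZ : IsHSBasis (Subalgebra.toSubmodule 𝒜.toSubalgebra) Z) {σ δ η g : ℝ}
    (hσ : σ = nthSingularValue (omegaMatrix (ω.dens (s + s)) Y X) m) (hσ0 : 0 < σ)
    (hδ0 : 0 < δ) (hη : η ≤ σ / 2) (hη' : 2 * δ ≤ η) (hg : g = 3 / (2 * σ))
    (hδσ : δ ≤ σ / 6) (est : Estimates d s) (hest : est.Accurate ω δ)
    (S : SVD (omegaMatrix est.two Y X)) (t : ℕ) :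
    Nuc (learnFCS Y X Z η est S t - ω.dens t)
      ((1 + g * √d * (m * (3 / 2 * g * δ * (1 + g)))) ^ t * (1 + m * (δ * g * (1 + g))) *
        (1 + g * (m * δ)) - 1) := by
  obtain ⟨hest1, hest2, hest3⟩ := hest
  set Ω := omegaMatrix (ω.dens (s + s)) Y X with hΩ
  set U := S.truncU η with hU
  have hUU : Uᴴ * U = 1 := S.truncU_isometry η
  have hUle : ∀ v, vecNorm (Uᴴ *ᵥ v) ≤ vecNorm v :=
    vecNorm_conjTranspose_mulVec_le_of_isometry hUU
  have hg0 : 0 < g := by rw [hg]; positivity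
  have hdiff : ∀ v, vecNorm ((omegaMatrix est.two Y X - Ω) *ᵥ v) ≤ δ * vecNorm v := fun v => by
    refine (vecNorm_mulVec_le _ v).trans (mul_le_mul_of_nonneg_right ?_ (vecNorm_nonneg v))
    rw [hΩ, ← omegaMatrix_sub]
    exact (hsNorm_omegaMatrix_le hY hX _).trans hest2
  have hdiff' : ∀ v, vecNorm ((Ω - omegaMatrix est.two Y X) *ᵥ v) ≤ δ * vecNorm v := fun v => by
    rw [← neg_sub, Matrix.neg_mulVec, ← zero_sub, vecNorm_sub_rev, sub_zero]
    exact hdiff v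
  have hAdiff : ∀ v, vecNorm ((Uᴴ * omegaMatrix est.two Y X - Uᴴ * Ω) *ᵥ v) ≤
      δ * vecNorm v := fun v => by
    rw [← Matrix.mul_sub, ← Matrix.mulVec_mulVec]
    exact (hUle _).trans (hdiff v)
  -- the operators attached to a right inverse of `Uᴴ Ω`
  let y : {i // η ≤ S.sv i} → Op d s := fun α => ∑ j, star (U j α) • Y j
  let x : Matrix ι {i // η ≤ S.sv i} ℂ → {i // η ≤ S.sv i} → Op d s :=
    fun G β => ∑ i, G i β • X i
  have hymem : ∀ α, y α ∈ blockAlg 𝒜 s := fun α =>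
    Submodule.sum_mem _ fun j _ => Submodule.smul_mem _ _ (hY.mem j)
  have hxmem : ∀ G β, x G β ∈ blockAlg 𝒜 s := fun G β =>
    Submodule.sum_mem _ fun j _ => Submodule.smul_mem _ _ (hX.mem j)
  have hynorm : ∀ α, hsNorm (y α) = 1 := fun α => by
    rw [hY.hsNorm_sum_smul]
    exact (vecNorm_star _).trans (vecNorm_col_of_isometry hUU α)
  have hxnorm : ∀ (G : Matrix ι {i // η ≤ S.sv i} ℂ) (c : ℝ),
      (∀ v, vecNorm (G *ᵥ v) ≤ c * vecNorm v) → ∀ β, hsNorm (x G β) ≤ c := fun G c hG β => by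
    rw [hX.hsNorm_sum_smul]
    have h := hG (Pi.single β 1)
    rw [Matrix.mulVec_single_one, vecNorm_single_one, mul_one] at h
    exact h
  have hdual : ∀ G : Matrix ι {i // η ≤ S.sv i} ℂ, Uᴴ * Ω * G = 1 → ∀ α β,
      ω.ev (s + s) (tens (y α) (x G β)) = if α = β then 1 else 0 := fun G hG α β => by
    rw [TIState.ev_apply, trace_mul_tens_sum, ← hΩ, hG, Matrix.one_apply]
  -- the number of singular values above the threshold
  have hcard_le : Fintype.card {i // η ≤ S.sv i} ≤ m := by
    have hη0 : 0 < η := by linarith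
    -- Only the crude bound 1/η on the pseudo-inverse is available yet; 2δ ≤ η makes the
    -- perturbation parameter at most 1/2.
    obtain ⟨G, hG, -⟩ := exists_rightInverse_of_perturbation
      (S.truncU_mul_pinv η hη0 fun _ h => h) (S.vecNorm_pinv_mulVec_le η hη0 fun _ h => h)
      hAdiff (inv_nonneg.2 hη0.le) hδ0.le (by
        rw [← div_eq_mul_inv, div_lt_one hη0]; linarith)
    exact R.card_le_of_dual hZ hymem (hxmem G) (hdual G hG)
  have hcard_ge := S.le_card_of_perturbation hm (hσ ▸ hσ0) hdiff' (by rw [← hσ]; linarith)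
  rw [← hσ] at hcard_ge
  -- The values above σ - δ are among those above η, and the two counts force equality. The
  -- pseudo-inverse bound thus improves from 1/η to 1/(σ - δ).
  have hgap : ∀ i, η ≤ S.sv i → σ - δ ≤ S.sv i := by
    rw [Fintype.card_subtype] at hcard_ge hcard_le
    have hsub : (Finset.univ.filter fun i => σ - δ ≤ S.sv i) ⊆
        Finset.univ.filter fun i => η ≤ S.sv i := by
      intro i hi
      simp only [Finset.mem_filter, Finset.mem_univ, true_and] at hi ⊢
      linarith
    have heq := Finset.eq_of_subset_of_card_le hsub (hcard_le.trans hcard_ge)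
    intro i hi
    have : i ∈ Finset.univ.filter fun i => η ≤ S.sv i := by simpa using hi
    rw [← heq] at this
    simpa using this
  have hcard : Fintype.card {i // η ≤ S.sv i} = m := by
    refine le_antisymm hcard_le (hcard_ge.trans ?_)
    exact Fintype.card_subtype_mono _ _ fun i (hi : σ - δ ≤ S.sv i) => by linarith
  -- the corrected pseudo-inverse
  set G := pinv (Uᴴ * omegaMatrix est.two Y X) with hG
  have hτ : 0 < σ - δ := by linarith
  have hag : (σ - δ)⁻¹ ≤ g := by
    rw [hg, inv_le_comm₀ hτ (by positivity), inv_div]; linarith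
  have hδa : δ * (σ - δ)⁻¹ < 1 := by
    rw [← div_eq_mul_inv, div_lt_one hτ]; linarith
  have hGb := S.vecNorm_pinv_mulVec_le η hτ hgap
  obtain ⟨G', hG'1, hG'b, hG'sub, hFb⟩ := exists_rightInverse_of_perturbation
    (S.truncU_mul_pinv η hτ hgap) hGb hAdiff (inv_nonneg.2 hτ.le) hδ0.le hδa
  set F := (Uᴴ * omegaMatrix est.two Y X - Uᴴ * Ω) * G with hF
  have hGg : ∀ v, vecNorm (G *ᵥ v) ≤ g * vecNorm v := fun v =>
    (hGb v).trans (mul_le_mul_of_nonneg_right hag (vecNorm_nonneg v))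
  have hG'g : ∀ v, vecNorm (G' *ᵥ v) ≤ g * vecNorm v := fun v => by
    refine (hG'b v).trans (mul_le_mul_of_nonneg_right ?_ (vecNorm_nonneg v))
    -- As δ ≤ σ/6, one has σ - 2δ ≥ 2σ/3, which is where g = 3/(2σ) comes from.
    have : (σ - δ)⁻¹ / (1 - δ * (σ - δ)⁻¹) = (σ - 2 * δ)⁻¹ := by
      have h1 : σ - δ ≠ 0 := hτ.ne'
      have h2 : σ - 2 * δ ≠ 0 := by linarith
      have h3 : 1 - δ * (σ - δ)⁻¹ = (σ - 2 * δ) * (σ - δ)⁻¹ := by field_simp; ring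
      rw [h3]; field_simp
    rw [this, hg, inv_le_comm₀ (by linarith) (by positivity), inv_div]
    linarith
  have hFg : ∀ v, vecNorm (F *ᵥ v) ≤ δ * g * vecNorm v := fun v =>
    (hFb v).trans (mul_le_mul_of_nonneg_right (mul_le_mul_of_nonneg_left hag hδ0.le)
      (vecNorm_nonneg v))
  have hsubb : ∀ v, vecNorm ((G' - G) *ᵥ v) ≤ g * (δ * g) * vecNorm v := fun v => by
    rw [hG'sub, ← Matrix.mulVec_mulVec, mul_assoc]
    exact (hG'g _).trans (mul_le_mul_of_nonneg_left (hFg v) hg0.le)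
  have hframe : DualFrame ω y (x G') g :=
    R.dualFrame hZ hymem (hxmem G') (fun β => (hynorm β).le) (hxnorm G' g hG'g) (hdual G' hG'1)
      hcard
  have hdens : ∀ n, hsNorm (ω.dens n) ≤ 1 := fun n =>
    hsNorm_le_one_of_posSemidef (ω.posSemidef n) (ω.trace_one n)
  rw [learnFCS_eq_sum_smul_mpoRow]
  refine hframe.nuc_mpo_sub_dens hg0.le hZ ?_ ?_ ?_ t
  · -- the row vector `ρ`
    have hcol : ∀ β, ‖hatRho Y X η est S β - ω.ev s (x G' β)‖ ≤ δ * g * (1 + g) := by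
      intro β
      have h1 : hatRho Y X η est S β = (est.one * x G β).trace := by
        simp only [hatRho, ← hU, ← hG, x, Matrix.vecMul, dotProduct, Matrix.mul_sum,
          Matrix.trace_sum, Matrix.mul_smul, Matrix.trace_smul, smul_eq_mul]
        exact Finset.sum_congr rfl fun i _ => mul_comm _ _
      -- The error splits into that of the estimated marginal, tested on the operators of `G`, and
      -- that of replacing `G` by `G'`, tested on the true marginal.
      have h2 : hatRho Y X η est S β - ω.ev s (x G' β) =
          ((est.one - ω.dens s) * x G β).trace - (ω.dens s * x (G' - G) β).trace := by
        have h3 : x (G' - G) β = x G' β - x G β := by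
          simp only [x, Matrix.sub_apply, sub_smul, Finset.sum_sub_distrib]
        rw [h1, h3, TIState.ev_apply, Matrix.sub_mul, Matrix.mul_sub, Matrix.trace_sub,
          Matrix.trace_sub]
        ring
      rw [h2]
      calc _ ≤ ‖((est.one - ω.dens s) * x G β).trace‖ + ‖(ω.dens s * x (G' - G) β).trace‖ :=
            norm_sub_le _ _
        _ ≤ δ * g + 1 * (g * (δ * g)) := by
            refine add_le_add ((norm_trace_mul_le _ _).trans ?_) ((norm_trace_mul_le _ _).trans ?_)
            · exact mul_le_mul hest1 (hxnorm G g hGg β) (hsNorm_nonneg _) hδ0.le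
            · exact mul_le_mul (hdens s) (hxnorm _ _ hsubb β) (hsNorm_nonneg _) zero_le_one
        _ = _ := by ring
    calc _ ≤ ∑ _β : {i // η ≤ S.sv i}, δ * g * (1 + g) := Finset.sum_le_sum fun β _ => hcol β
      _ = _ := by rw [Finset.sum_const, Finset.card_univ, hcard, nsmul_eq_mul]
  · -- the transfer operators
    let Δ : κ → Matrix {i // η ≤ S.sv i} {i // η ≤ S.sv i} ℂ := fun k =>
      hatK Y X η est S (Z k) - Uᴴ * omegaMatrixAt (ω.dens (s + 1 + s)) Y X (Z k) * G'
    have htr : ∀ β γ, (∑ k, hatK Y X η est S (Z k) β γ • oneSite (Z k)) -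
        transfer ω y (x G') β γ = ∑ k, Δ k β γ • oneSite (Z k) := by
      intro β γ
      have h1 : transfer ω y (x G') β γ ∈ blockAlg 𝒜 1 := ptr_mem (ω.mem _) _ _
      rw [hZ.oneSite.expand h1, ← Finset.sum_sub_distrib]
      refine Finset.sum_congr rfl fun k _ => ?_
      rw [trace_transfer_mul, TIState.ev_apply, trace_mul_tens_tens_sum, ← sub_smul]
      rfl
    simp only [htr, hZ.oneSite.hsNorm_sum_smul]
    -- The factor `m` comes from Cauchy-Schwarz over the `m²` pairs (β, γ).
    rw [← hcard]
    refine sum_sum_vecNorm_le (by positivity) ?_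
    have hΔ : ∀ k, hsNorm (Δ k) ^ 2 ≤
        2 * g ^ 2 * hsNorm (omegaMatrixAt (est.three - ω.dens (s + 1 + s)) Y X (Z k)) ^ 2 +
        2 * (g * (δ * g)) ^ 2 * hsNorm (omegaMatrixAt (ω.dens (s + 1 + s)) Y X (Z k)) ^ 2 := by
      intro k
      set A := omegaMatrixAt (ω.dens (s + 1 + s)) Y X (Z k)
      set B := omegaMatrixAt (est.three - ω.dens (s + 1 + s)) Y X (Z k) with hB
      have hUN : ∀ N : Matrix ι {i // η ≤ S.sv i} ℂ, hsNorm (Uᴴ * N) ≤ hsNorm N := fun N => by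
        have := hsNorm_mul_le_of_left (M := Uᴴ) (c := 1)
          (fun v => (hUle v).trans (one_mul _).ge) zero_le_one N
        rwa [one_mul] at this
      have h1 : Δ k = Uᴴ * (B * G) + (-1 : ℂ) • (Uᴴ * (A * (G' - G))) := by
        simp only [Δ, hatK, ← hU, ← hG, hB, omegaMatrixAt_sub, Matrix.sub_mul,
          Matrix.mul_sub, Matrix.mul_assoc, neg_smul, one_smul]
        abel
      have h2 : hsNorm (Δ k) ≤ g * hsNorm B + g * (δ * g) * hsNorm A := by
        rw [h1]
        refine (hsNorm_add_le _ _).trans (add_le_add ?_ ?_)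
        · exact (hUN _).trans (hsNorm_mul_le_of_right hg0.le hGg _)
        · rw [hsNorm_smul, norm_neg, norm_one, one_mul]
          exact (hUN _).trans (hsNorm_mul_le_of_right (by positivity) hsubb _)
      calc hsNorm (Δ k) ^ 2 ≤ (g * hsNorm B + g * (δ * g) * hsNorm A) ^ 2 :=
            pow_le_pow_left₀ (hsNorm_nonneg _) h2 2
        _ ≤ 2 * ((g * hsNorm B) ^ 2 + (g * (δ * g) * hsNorm A) ^ 2) := add_sq_le
        _ = _ := by ring
    have hB := (sum_hsNorm_omegaMatrixAt_sq_le hY hX hZ (est.three - ω.dens (s + 1 + s))).trans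
      (pow_le_pow_left₀ (hsNorm_nonneg _) hest3 2)
    have hA := (sum_hsNorm_omegaMatrixAt_sq_le hY hX hZ (ω.dens (s + 1 + s))).trans
      (pow_le_pow_left₀ (hsNorm_nonneg _) (hdens _) 2)
    refine (Finset.sum_le_sum fun k _ => hΔ k).trans ?_
    rw [Finset.sum_add_distrib, ← Finset.mul_sum, ← Finset.mul_sum]
    calc _ ≤ 2 * g ^ 2 * δ ^ 2 + 2 * (g * (δ * g)) ^ 2 * 1 ^ 2 := by gcongr
      -- Four times the difference of the two sides is (gδ)² ((1 - g)² + 20 g), which is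
      -- nonnegative.
      _ ≤ (3 / 2 * g * δ * (1 + g)) ^ 2 := by
        have h1 : 0 ≤ (g * δ) ^ 2 * ((1 - g) ^ 2 + 16 * g) := by positivity
        nlinarith
  · -- the column vector `e`
    have hcol : ∀ β, ‖hatE Y X η est S β - ω.ev s (y β)‖ ≤ δ := by
      intro β
      have h1 : hatE Y X η est S β - ω.ev s (y β) = ((est.one - ω.dens s) * y β).trace := by
        simp only [hatE, ← hU, y, TIState.ev_apply, Matrix.mulVec, dotProduct, Matrix.mul_sum,
          Matrix.trace_sum, Matrix.mul_smul, Matrix.trace_smul, smul_eq_mul, Matrix.sub_mul,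
          Matrix.trace_sub, mul_sub, Finset.sum_sub_distrib, Matrix.conjTranspose_apply]
      rw [h1]
      refine (norm_trace_mul_le _ _).trans ?_
      rw [hynorm, mul_one]
      exact hest1
    calc _ ≤ ∑ _β : {i // η ≤ S.sv i}, δ := Finset.sum_le_sum fun β _ => hcol β
      _ = _ := by rw [Finset.sum_const, Finset.card_univ, hcard, nsmul_eq_mul]

end Accuracy

end FCS

end

theorem theorem1 {d : ℕ} (𝒜 : StarSubalgebra ℂ (Matrix (Fin d) (Fin d) ℂ))
    (ω : FCS.TIState 𝒜) (m : ℕ) (hm : FCS.IsFinitelyCorrelatedOfDim ω m)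
    (t₁ t₂ : ℕ) (hΩ : Module.finrank ℂ (LinearMap.range (FCS.omegaMap ω t₁ t₂)) = m)
    (s : ℕ) (hs : max t₁ t₂ ≤ s)
    {ι κ : Type*} [Fintype ι] [DecidableEq ι] [Fintype κ] [DecidableEq κ]
    (Y X : ι → FCS.Op d s) (Z : κ → Matrix (Fin d) (Fin d) ℂ)
    (hY : FCS.IsHSBasis (FCS.blockAlg 𝒜 s) Y) (hX : FCS.IsHSBasis (FCS.blockAlg 𝒜 s) X)
    (hZ : FCS.IsHSBasis (Subalgebra.toSubmodule 𝒜.toSubalgebra) Z)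
    (t : ℕ) (ht : 1 ≤ t) (ε : ℝ) (hε : 0 < ε) (hε' : ε < 1)
    (σ : ℝ) (hσ : σ = FCS.nthSingularValue (FCS.omegaMatrix (ω.dens (s + s)) Y X) m)
    (δ : ℝ) (hδ : δ = ε * σ ^ 3 / (20 * t * m * √d))
    (η : ℝ) (hη : η ≤ σ / 2) (hη' : 2 * δ ≤ η) :
    (∀ est : FCS.Estimates d s, est.Accurate ω δ →
      ∀ S : FCS.SVD (FCS.omegaMatrix est.two Y X),
        FCS.trDist (FCS.learnFCS Y X Z η est S t) (ω.dens t) ≤ ε) ∧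
    (∀ {Θ : Type*} [MeasurableSpace Θ] (n : ℕ)
      (M : FCS.Measurement (Fin n → Fin (s + 1 + s) → Fin d) Θ)
      (est : Θ → FCS.Estimates d s) (S : ∀ θ, FCS.SVD (FCS.omegaMatrix (est θ).two Y X))
      (μ : MeasureTheory.Measure Θ),
      M.IsOutcomeLaw (FCS.tensorProd fun _ : Fin n => ω.dens (s + 1 + s)) μ →
      ∀ p : ENNReal, 1 - p ≤ μ {θ | (est θ).Accurate ω δ} →
        1 - p ≤ μ {θ | FCS.trDist (FCS.learnFCS Y X Z η (est θ) (S θ) t) (ω.dens t) ≤ ε}) := by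
  have hm1 := hm.one_le
  have hd1 := ω.one_le_dim
  have hσ0 : 0 < σ := hσ ▸ FCS.nthSingularValue_omegaMatrix_pos hm1 hΩ hs hY hX
  -- The matrix of `Ω` consists of orthonormal coefficients of a density matrix, whose
  -- Hilbert-Schmidt norm is at most 1.
  have hσ1 : σ ≤ 1 := by
    rw [hσ] at hσ0 ⊢
    exact (FCS.nthSingularValue_le_hsNorm _ hm1 hσ0).trans
      ((FCS.hsNorm_omegaMatrix_le hY hX _).trans
        (FCS.hsNorm_le_one_of_posSemidef (ω.posSemidef _) (ω.trace_one _)))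
  have hd' : 1 ≤ √(d : ℝ) := Real.one_le_sqrt.2 (by exact_mod_cast hd1)
  have hm' : (1 : ℝ) ≤ m := by exact_mod_cast hm1
  have ht' : (1 : ℝ) ≤ t := by exact_mod_cast ht
  have hδ0 : 0 < δ := by rw [hδ]; positivity
  have hδσ : δ ≤ σ / 6 := by
    have h1 : 20 ≤ 20 * (t : ℝ) * m * √d := by
      have := one_le_mul_of_one_le_of_one_le (one_le_mul_of_one_le_of_one_le ht' hm') hd'
      linarith
    have h2 : σ ^ 3 ≤ σ := by
      have := pow_le_pow_of_le_one hσ0.le hσ1 (show 1 ≤ 3 by norm_num)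
      rwa [pow_one] at this
    have h3 : ε * σ ^ 3 ≤ σ := (mul_le_of_le_one_left (by positivity) hε'.le).trans h2
    rw [hδ]
    calc ε * σ ^ 3 / (20 * t * m * √d) ≤ σ / 20 := by gcongr
      _ ≤ σ / 6 := by linarith
  obtain ⟨R⟩ := hm.1
  have key : ∀ est : FCS.Estimates d s, est.Accurate ω δ →
      ∀ S : FCS.SVD (FCS.omegaMatrix est.two Y X),
        FCS.trDist (FCS.learnFCS Y X Z η est S t) (ω.dens t) ≤ ε := by
    intro est hest S
    have h1 := (FCS.nuc_learnFCS_sub_dens R hm1 hY hX hZ hσ hσ0 hδ0 hη hη' rfl hδσ est hest S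
      t).traceNorm_le
    have h2 := FCS.total_error_le hd1 hm1 ht hε hε' hσ0 hσ1 hδ rfl
    rw [FCS.trDist]
    linarith
  -- The bound in the first part is deterministic, so the event of accurate estimates is contained
  -- in the event of a good output.
  refine ⟨key, fun n M est S μ _ p hp => hp.trans (MeasureTheory.measure_mono fun θ hθ => ?_)⟩
  exact key (est θ) hθ (S θ)
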